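/- Let $n\ge 2$, let $\Omega\subset\mathbb R^n$ be a bounded open set and let $m\in\mathbb N$. Let $\varphi:\Omega\times[0,\infty]\to[0,\infty]$ be a weak $\Phi$-function, i.e.: $x\mapsto\varphi(x,|f(x)|)$ is measurable for every measurable $f:\Omega\to[-\infty,\infty]$; and for every $x\in\Omega$, $t\mapsto\varphi(x,t)$ is increasing, $\varphi(x,0)=\lim_{t\to0^+}\varphi(x,t)=0$, $\varphi(x,\infty)=\lim_{t\to\infty}\varphi(x,t)=\infty$, and $\frac{\varphi(x,s)}{s}\le L\,\frac{\varphi(x,t)}{t}$ for $0<s\le t<\infty$ with a constant $L\ge1$ independent of $x$. Write $\varphi^*(x,t)=\sup_{s\ge0}\{st-\varphi(x,s)\}$ for the conjugate. For $\psi\in\{\varphi,\varphi^*\}$ and measurable $f$ on $\Omega$ with values in a Euclidean space, let $\|f\|_\psi=\|f\|_{L^\psi}=\inf\{\lambda>0:\int_\Omega\psi(x,|f(x)|/\lambda)\,dx\le1\}$ (with $\inf\emptyset=\infty$), let $L^\psi$ be the set of those $f$ with $\int_\Omega\psi(x,\lambda|f(x)|)\,dx<\infty$ for some $\lambda>0$,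 and let $$\|f\|_{(L^{\psi})'}=\sup\Big\{\int_\Omega |f|\,|g|\,dx:\ g:\Omega\to\mathbb R\text{ measurable},\ \|g\|_{\psi}\le1\Big\}.$$ Let $C^1_0(\Omega;\cdot)$ denote continuously differentiable maps with compact support in $\Omega$. For $u\in L^1_{\rm loc}(\Omega;\mathbb R^m)$ put $$V^m_\varphi(u)=\sup\Big\{\sum_{\alpha=1}^m\int_\Omega u_\alpha\,\mathrm{div}\,w_\alpha\,dx:\ w=(w_1,\dots,w_m)\in[C^1_0(\Omega;\mathbb R^n)]^m,\ \|w\|_{\varphi^*}\le1\Big\}\in[0,\infty].$$ Then for every $u\in W^{1,1}_{\rm loc}(\Omega;\mathbb R^m)$, with weak gradient $\nabla u:\Omega\to\mathbb R^{m\times n}$ (Euclidean norm on $\mathbb R^{m\times n}$), $$V^m_\varphi(u)\le\|\nabla u\|_{(L^{\varphi^*})'}.$$ 1. If $C^1_0(\Omega;\mathbb R^{m\times n})$ is dense in $L^{\varphi^*}(\Omega;\mathbb R^{m\times n})$ (i.e. for every $w\in L^{\varphi^*}(\Omega;\mathbb R^{m\times n})$ and $\varepsilon>0$ there is $v\in C^1_0(\Omega;\mathbb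 R^{m\times n})$ with $\|v-w\|_{\varphi^*}<\varepsilon$), then $V^m_\varphi(u)=\|\nabla u\|_{(L^{\varphi^*})'}$ for every $u\in W^{1,1}_{\rm loc}(\Omega;\mathbb R^m)$. 2. Suppose that $\varphi$ satisfies the following three conditions. (A0) There is $\beta\in(0,1]$ with $\varphi(x,\beta)\le1\le\varphi(x,1/\beta)$ for all $x\in\Omega$. (A1) For every $K>0$ there is $\beta\in(0,1]$ such that $\varphi(x,\beta t)\le\varphi(y,t)+1$ whenever $x,y\in\Omega$ and $\varphi(y,t)\in[0,K/|x-y|^n]$ (where $K/0=\infty$). (aDec) There are $q\in(0,\infty)$ and $L_q\ge1$ with $\frac{\varphi(x,t)}{t^q}\le L_q\frac{\varphi(x,s)}{s^q}$ for all $x\in\Omega$ and $0<s\le t<\infty$. Then there is a constant $C>0$, independent of $u$, such that for every $u\in W^{1,1}_{\rm loc}(\Omega;\mathbb R^m)$ $$V^m_\varphi(u)\le C\,\|\nabla u\|_{L^\varphi}\qquad\text{and}\qquad\|\nabla u\|_{L^\varphi}\le C\,V^m_\varphi(u).$$ -/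

import Mathlib

open MeasureTheory Set Filter Topology
open scoped NNReal ENNReal

noncomputable section

namespace GenOrlicz

/-- Euclidean space `ℝⁿ`. -/
abbrev Vec (n : ℕ) : Type := EuclideanSpace ℝ (Fin n)

/-- The space `ℝ^{m × n}`, as `m` rows in `ℝⁿ`; its norm is the Euclidean (Frobenius) norm. -/
abbrev Mat (m n : ℕ) : Type := PiLp 2 (fun _ : Fin m => Vec n)

/-! ### Weak `Φ`-functions -/

/-- `φ : Ω × [0,∞] → [0,∞]` is a weak `Φ`-function on `Ω`. (Values at `x ∉ Ω` are irrelevant.)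
Lebesgue measurability on `Ω` is a.e.-measurability for Lebesgue measure restricted to `Ω`. -/
structure IsWeakPhi {n : ℕ} (Ω : Set (Vec n)) (φ : Vec n → ℝ≥0∞ → ℝ≥0∞) : Prop where
  measurable_comp : ∀ f : Vec n → ℝ≥0∞, AEMeasurable f (volume.restrict Ω) →
    AEMeasurable (fun x => φ x (f x)) (volume.restrict Ω)
  mono : ∀ x ∈ Ω, Monotone (φ x)
  map_zero : ∀ x ∈ Ω, φ x 0 = 0
  tendsto_zero : ∀ x ∈ Ω, Tendsto (φ x) (𝓝[>] 0) (𝓝 0)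
  map_top : ∀ x ∈ Ω, φ x ∞ = ∞
  tendsto_top : ∀ x ∈ Ω, Tendsto (φ x) (𝓝[<] ∞) (𝓝 ∞)
  almostIncreasing : ∃ L : ℝ≥0, 1 ≤ L ∧ ∀ x ∈ Ω, ∀ s t : ℝ≥0∞, 0 < s → s ≤ t → t < ∞ →
    φ x s / s ≤ L * (φ x t / t)

/-- Condition (A0). -/
def CondA0 {n : ℕ} (Ω : Set (Vec n)) (φ : Vec n → ℝ≥0∞ → ℝ≥0∞) : Prop :=
  ∃ β : ℝ≥0, 0 < β ∧ β ≤ 1 ∧ ∀ x ∈ Ω, φ x (β : ℝ≥0∞) ≤ 1 ∧ 1 ≤ φ x ((β : ℝ≥0∞)⁻¹)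

/-- Condition (A1); for `x = y` the bound `K / |x - y| ^ n` is `∞`. -/
def CondA1 {n : ℕ} (Ω : Set (Vec n)) (φ : Vec n → ℝ≥0∞ → ℝ≥0∞) : Prop :=
  ∀ K : ℝ≥0, 0 < K → ∃ β : ℝ≥0, 0 < β ∧ β ≤ 1 ∧ ∀ x ∈ Ω, ∀ y ∈ Ω, ∀ t : ℝ≥0∞,
    φ y t ≤ (K : ℝ≥0∞) / edist x y ^ n → φ x (β * t) ≤ φ y t + 1

/-- Condition (aDec): `t ↦ φ(x,t) / t ^ q` is almost decreasing on `(0,∞)`, uniformly in `x`,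
for some finite `q > 0`. -/
def CondADec {n : ℕ} (Ω : Set (Vec n)) (φ : Vec n → ℝ≥0∞ → ℝ≥0∞) : Prop :=
  ∃ q : ℝ, 0 < q ∧ ∃ L : ℝ≥0, 1 ≤ L ∧ ∀ x ∈ Ω, ∀ s t : ℝ≥0∞, 0 < s → s ≤ t → t < ∞ →
    φ x t / t ^ q ≤ L * (φ x s / s ^ q)

/-- The conjugate `φ*(x,t) = sup_{s ≥ 0} (s t - φ(x,s))`. The subtraction of `ℝ≥0∞` truncates
negative values to `0`; as `s = 0` contributes `0` to the supremum when `φ(x,0) = 0`,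
this does not change it. -/
def conj {n : ℕ} (φ : Vec n → ℝ≥0∞ → ℝ≥0∞) (x : Vec n) (t : ℝ≥0∞) : ℝ≥0∞ :=
  ⨆ s : ℝ≥0, ((s : ℝ≥0∞) * t - φ x (s : ℝ≥0∞))

/-! ### Generalized Orlicz spaces -/

/-- The quasimodular `ϱ_φ(f) = ∫_Ω φ(x, |f(x)|) dx`. -/
def modular {n : ℕ} {F : Type*} [NormedAddCommGroup F] (Ω : Set (Vec n))
    (φ : Vec n → ℝ≥0∞ → ℝ≥0∞) (f : Vec n → F) : ℝ≥0∞ :=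
  ∫⁻ x in Ω, φ x ‖f x‖ₑ

/-- `f ∈ L^φ(Ω; F)`: `f` is measurable and `ϱ_φ(c f) < ∞` for some `c > 0`. -/
def MemOrlicz {n : ℕ} {F : Type*} [NormedAddCommGroup F] [NormedSpace ℝ F] (Ω : Set (Vec n))
    (φ : Vec n → ℝ≥0∞ → ℝ≥0∞) (f : Vec n → F) : Prop :=
  AEStronglyMeasurable f (volume.restrict Ω) ∧
    ∃ c : ℝ, 0 < c ∧ modular Ω φ (fun x => c • f x) < ∞

/-- The Luxemburg quasinorm `‖f‖_φ = inf {r > 0 | ϱ_φ(f / r) ≤ 1}`, which is `∞` if no such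
`r` exists. -/
def luxNorm {n : ℕ} {F : Type*} [NormedAddCommGroup F] [NormedSpace ℝ F] (Ω : Set (Vec n))
    (φ : Vec n → ℝ≥0∞ → ℝ≥0∞) (f : Vec n → F) : ℝ≥0∞ :=
  ⨅ (r : ℝ) (_ : 0 < r) (_ : modular Ω φ (fun x => r⁻¹ • f x) ≤ 1), ENNReal.ofReal r

/-- The norm of `|f|` in the associate space `(L^ψ(Ω))'`: the supremum of `∫_Ω |f| g dx` over
measurable `g` with `‖g‖_ψ ≤ 1`. As `g` may be replaced by `|g|`, the integrand is taken
nonnegative, so that the integral always exists in `[0,∞]`. -/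
def assocNorm {n : ℕ} {F : Type*} [NormedAddCommGroup F] (Ω : Set (Vec n))
    (ψ : Vec n → ℝ≥0∞ → ℝ≥0∞) (f : Vec n → F) : ℝ≥0∞ :=
  ⨆ (g : Vec n → ℝ) (_ : AEMeasurable g (volume.restrict Ω)) (_ : luxNorm Ω ψ g ≤ 1),
    ∫⁻ x in Ω, ‖f x‖ₑ * ‖g x‖ₑ

/-! ### Test fields, the dual norm, weak gradients -/

/-- `w ∈ C¹₀(Ω; F)`: continuously differentiable with compact support contained in `Ω`
(extended by zero to `ℝⁿ`). -/
structure IsTestField {n : ℕ} {F : Type*} [NormedAddCommGroup F] [NormedSpace ℝ F]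
    (Ω : Set (Vec n)) (w : Vec n → F) : Prop where
  contDiff : ContDiff ℝ 1 w
  hasCompactSupport : HasCompactSupport w
  tsupport_subset : tsupport w ⊆ Ω

/-- The classical partial derivative `∂ᵢ f (x)`. -/
def partialDeriv {n : ℕ} (i : Fin n) (f : Vec n → ℝ) (x : Vec n) : ℝ :=
  fderiv ℝ f x (EuclideanSpace.single i 1)

/-- The divergence of a vector field. -/
def divergence {n : ℕ} (v : Vec n → Vec n) (x : Vec n) : ℝ :=
  ∑ i : Fin n, partialDeriv i (fun y => v y i) x

/-- The dual norm `V_φ^m(u)`: the supremum of `∑_α ∫_Ω u_α div w_α dx` over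
`w ∈ C¹₀(Ω; ℝⁿ)^m` with `‖w‖_{φ*} ≤ 1`. As `w = 0` is admissible, the supremum is nonnegative
and does not change when negative values are replaced by `0`. -/
def dualNorm {n m : ℕ} (Ω : Set (Vec n)) (φ : Vec n → ℝ≥0∞ → ℝ≥0∞) (u : Vec n → Vec m) :
    ℝ≥0∞ :=
  ⨆ (w : Vec n → Mat m n) (_ : IsTestField Ω w) (_ : luxNorm Ω (conj φ) w ≤ 1),
    ENNReal.ofReal (∑ α : Fin m, ∫ x in Ω, u x α * divergence (fun y => w y α) x)

/-- `u ∈ W^{1,1}_loc(Ω; ℝ^m)` and its weak gradient `∇u` is `G`, whose `α`-th row is `∇u_α`. -/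
structure HasWeakGradient {n m : ℕ} (Ω : Set (Vec n)) (u : Vec n → Vec m)
    (G : Vec n → Mat m n) : Prop where
  locallyIntegrable : LocallyIntegrableOn u Ω
  locallyIntegrable_grad : LocallyIntegrableOn G Ω
  integral_eq : ∀ η : Vec n → ℝ, ContDiff ℝ (⊤ : ℕ∞) η → HasCompactSupport η → tsupport η ⊆ Ω →
    ∀ (α : Fin m) (i : Fin n),
      ∫ x in Ω, u x α * partialDeriv i η x = - ∫ x in Ω, G x α i * η x

/-- Every element of `L^ψ(Ω; ℝ^{m × n})` is a limit in `L^ψ` of elements of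
`C¹₀(Ω; ℝ^{m × n})`. -/
def TestFieldsDense {n : ℕ} (m : ℕ) (Ω : Set (Vec n)) (ψ : Vec n → ℝ≥0∞ → ℝ≥0∞) : Prop :=
  ∀ w : Vec n → Mat m n, MemOrlicz Ω ψ w → ∀ ε : ℝ≥0∞, 0 < ε →
    ∃ v : Vec n → Mat m n, IsTestField Ω v ∧ luxNorm Ω ψ (fun x => v x - w x) < ε

end GenOrlicz

end

/-! Integration by parts turns `dualNorm` into the supremum of `∫ ⟨∇u, w⟩` over `C¹₀` fields in the
unit ball of `L^{φ*}`, so Cauchy–Schwarz bounds it by the associate norm.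

For the converse, a competitor `g` in the associate norm is truncated to a bounded function on a
compact subset of `Ω` and pointed in the direction of `∇u` (`assocNorm_le_of_forall_bounded`). Such
a field `w` need not be smooth. It suffices to find test fields `z_k → w` a.e., uniformly bounded
and supported in one compact subset of `Ω`, with `‖z_k‖_{φ*}` controlled: as `∇u` is locally
integrable, dominated convergence passes to the limit in `∫ ⟨∇u, z_k⟩`.

Under density, fields `v_k` approximating `w` at rate `4^{-k}` converge a.e. Composing them with a
Lipschitz truncation and multiplying by a cutoff, both of which fix `w`, restores boundedness and
compact support while `‖z_k - w‖_{φ*} → 0`. The norms are then at most `1 + o(1)`, which gives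
equality.

In the second part the `z_k` are mollifications of `w`. Condition (A1) yields a Jensen-type
inequality for `φ*` (`conj_lintegral_le`), hence a uniform bound `Q` for mollification on `L^{φ*}`
(`exists_luxNorm_mollify_le`), and the associate norm is at most `Q` times the dual norm. It remains
to compare the associate norm with `‖∇u‖_φ`: Hölder's inequality in one direction, and in the other
the near-extremal function `φ(x,|f|)/(L|f|)` of `setLIntegral_le_one_of_assocNorm_lt`. -/

noncomputable section

namespace GenOrlicz

/-! ### Young's inequality, convexity and measurability of the conjugate -/

section Conjugate

variable {n : ℕ} {φ : Vec n → ℝ≥0∞ → ℝ≥0∞}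

/-- Young's inequality. -/
theorem mul_le_add_conj (x : Vec n) (s : ℝ≥0) (t : ℝ≥0∞) :
    (s : ℝ≥0∞) * t ≤ φ x s + conj φ x t := by
  have h : (s : ℝ≥0∞) * t - φ x s ≤ conj φ x t :=
    le_iSup (fun s : ℝ≥0 => (s : ℝ≥0∞) * t - φ x (s : ℝ≥0∞)) s
  calc (s : ℝ≥0∞) * t ≤ φ x s + ((s : ℝ≥0∞) * t - φ x s) := le_add_tsub
    _ ≤ _ := by gcongr

theorem conj_le_iff {x : Vec n} {t a : ℝ≥0∞} :
    conj φ x t ≤ a ↔ ∀ s : ℝ≥0, (s : ℝ≥0∞) * t ≤ φ x s + a := by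
  simp only [conj, iSup_le_iff, tsub_le_iff_left]

theorem conj_mono (x : Vec n) : Monotone (conj φ x) := fun a b hab =>
  conj_le_iff.2 fun s => le_trans (by gcongr) (mul_le_add_conj x s b)

theorem conj_zero (x : Vec n) : conj φ x 0 = 0 := by
  simp [conj]

/-- The conjugate is convex. -/
theorem conj_convex (x : Vec n) {a b : ℝ≥0∞} (hab : a + b = 1) (p q : ℝ≥0∞) :
    conj φ x (a * p + b * q) ≤ a * conj φ x p + b * conj φ x q := by
  refine conj_le_iff.2 fun s => ?_
  calc (s : ℝ≥0∞) * (a * p + b * q) = a * (s * p) + b * (s * q) := by ring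
    _ ≤ a * (φ x s + conj φ x p) + b * (φ x s + conj φ x q) := by
        gcongr <;> exact mul_le_add_conj x s _
    _ = (a + b) * φ x s + (a * conj φ x p + b * conj φ x q) := by ring
    _ = _ := by rw [hab, one_mul]

theorem conj_mul_le (x : Vec n) {a : ℝ≥0∞} (ha : a ≤ 1) (t : ℝ≥0∞) :
    conj φ x (a * t) ≤ a * conj φ x t := by
  have := conj_convex (φ := φ) x (add_tsub_cancel_of_le ha) t 0
  simpa [conj_zero] using this

theorem IsWeakPhi.exists_nnreal_le {Ω : Set (Vec n)} (hφ : IsWeakPhi Ω φ) {x : Vec n}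
    (hx : x ∈ Ω) {ε : ℝ≥0∞} (hε : 0 < ε) : ∃ s : ℝ≥0, 0 < s ∧ φ x s ≤ ε := by
  have h1 : ∀ᶠ t in 𝓝[>] (0 : ℝ≥0∞), φ x t < ε := (hφ.tendsto_zero x hx).eventually_lt_const hε
  have h2 : ∀ᶠ t in 𝓝[>] (0 : ℝ≥0∞), t < 1 :=
    mem_nhdsWithin_of_mem_nhds (Iio_mem_nhds one_pos)
  obtain ⟨t, ⟨h3, h4⟩, h5⟩ := ((h1.and h2).and self_mem_nhdsWithin).exists
  lift t to ℝ≥0 using (h4.trans ENNReal.one_lt_top).ne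
  exact ⟨t, by simpa using h5, h3.le⟩

/-- A countable supremum gives measurability. For finite `t`, `s * t` is left-continuous in `s` and
`φ x` is monotone, so `s` may be lowered to a rational; for `t = ∞` one rational `q > 0` with `φ x q
≤ 1` already gives the value `∞`. -/
theorem conj_eq_iSup_rat {Ω : Set (Vec n)} (hφ : IsWeakPhi Ω φ) {x : Vec n} (hx : x ∈ Ω)
    (t : ℝ≥0∞) :
    conj φ x t = ⨆ q : ℚ, ((q : ℝ).toNNReal : ℝ≥0∞) * t - φ x ((q : ℝ).toNNReal : ℝ≥0∞) := by
  refine le_antisymm ?_ (iSup_le fun q =>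
    le_iSup (fun s : ℝ≥0 => (s : ℝ≥0∞) * t - φ x (s : ℝ≥0∞)) _)
  set A := ⨆ q : ℚ, ((q : ℝ).toNNReal : ℝ≥0∞) * t - φ x ((q : ℝ).toNNReal : ℝ≥0∞) with hA
  have hq : ∀ q : ℚ, ((q : ℝ).toNNReal : ℝ≥0∞) * t ≤ φ x ((q : ℝ).toNNReal : ℝ≥0∞) + A :=
    fun q => tsub_le_iff_left.1 (le_iSup
      (fun q : ℚ => ((q : ℝ).toNNReal : ℝ≥0∞) * t - φ x ((q : ℝ).toNNReal : ℝ≥0∞)) q)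
  rcases eq_or_ne t ∞ with rfl | ht
  · obtain ⟨s, hs, hs1⟩ := hφ.exists_nnreal_le hx one_pos
    obtain ⟨q, hq0, hqs⟩ := exists_rat_btwn (show (0 : ℝ) < s from hs)
    have h1 := hq q
    have h2 : 0 < (q : ℝ).toNNReal := Real.toNNReal_pos.2 hq0
    have h3 : φ x ((q : ℝ).toNNReal : ℝ≥0∞) ≤ 1 := by
      refine le_trans (hφ.mono x hx ?_) hs1
      exact_mod_cast Real.toNNReal_le_iff_le_coe.2 hqs.le
    rw [ENNReal.mul_top (by exact_mod_cast h2.ne'), top_le_iff, ENNReal.add_eq_top] at h1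
    rcases h1 with h1 | h1
    · rw [h1] at h3; simp at h3
    · rw [h1]; exact le_top
  · refine conj_le_iff.2 fun s => ?_
    rcases eq_or_ne s 0 with rfl | hs
    · simp
    have hcont : Tendsto (fun r : ℝ≥0 => (r : ℝ≥0∞) * t) (𝓝[<] s) (𝓝 ((s : ℝ≥0∞) * t)) := by
      refine (ENNReal.Tendsto.mul_const ?_ (Or.inr ht)).mono_left nhdsWithin_le_nhds
      exact (ENNReal.continuous_coe.tendsto s)
    have : (𝓝[<] s).NeBot := nhdsLT_neBot_of_exists_lt ⟨0, pos_iff_ne_zero.2 hs⟩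
    refine le_of_tendsto hcont ?_
    filter_upwards [self_mem_nhdsWithin] with r hr
    obtain ⟨q, hrq, hqs⟩ := exists_rat_btwn (show (r : ℝ) < s from hr)
    calc (r : ℝ≥0∞) * t ≤ ((q : ℝ).toNNReal : ℝ≥0∞) * t := by
          gcongr
          exact NNReal.le_toNNReal_of_coe_le hrq.le
      _ ≤ φ x ((q : ℝ).toNNReal : ℝ≥0∞) + A := hq q
      _ ≤ _ := by
          gcongr
          refine hφ.mono x hx ?_
          exact_mod_cast Real.toNNReal_le_iff_le_coe.2 hqs.le

theorem aemeasurable_conj {Ω : Set (Vec n)} (hΩ : MeasurableSet Ω) (hφ : IsWeakPhi Ω φ)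
    {f : Vec n → ℝ≥0∞} (hf : AEMeasurable f (volume.restrict Ω)) :
    AEMeasurable (fun x => conj φ x (f x)) (volume.restrict Ω) := by
  have h : AEMeasurable (fun x => ⨆ q : ℚ, ((q : ℝ).toNNReal : ℝ≥0∞) * f x
      - φ x ((q : ℝ).toNNReal : ℝ≥0∞)) (volume.restrict Ω) :=
    AEMeasurable.iSup fun q => (hf.const_mul _).sub (hφ.measurable_comp _ aemeasurable_const)
  refine h.congr ?_
  filter_upwards [ae_restrict_mem hΩ] with x hx
  exact (conj_eq_iSup_rat hφ hx (f x)).symm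

end Conjugate

/-! ### Luxemburg norm and modular -/

section LuxNorm

variable {n : ℕ} {Ω : Set (Vec n)} {ψ : Vec n → ℝ≥0∞ → ℝ≥0∞}
  {F : Type*} [NormedAddCommGroup F] {E : Type*} [NormedAddCommGroup E]

theorem modular_mono_ae (hΩ : MeasurableSet Ω) (hψ : ∀ x ∈ Ω, Monotone (ψ x))
    {f : Vec n → F} {g : Vec n → E} (h : ∀ᵐ x ∂volume.restrict Ω, ‖f x‖ₑ ≤ ‖g x‖ₑ) :
    modular Ω ψ f ≤ modular Ω ψ g := by
  refine lintegral_mono_ae ?_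
  filter_upwards [ae_restrict_mem hΩ, h] with x hx h
  exact hψ x hx h

variable [NormedSpace ℝ F] [NormedSpace ℝ E]

/-- The strict inequality avoids the question whether the infimum is attained. -/
theorem modular_le_one_of_luxNorm_lt (hΩ : MeasurableSet Ω) (hψ : ∀ x ∈ Ω, Monotone (ψ x))
    {f : Vec n → F} {R : ℝ} (h : luxNorm Ω ψ f < ENNReal.ofReal R) :
    modular Ω ψ (fun x => R⁻¹ • f x) ≤ 1 := by
  simp only [luxNorm, iInf_lt_iff] at h
  obtain ⟨r, hr, h1, h2⟩ := h
  have h3 : r < R := (ENNReal.ofReal_lt_ofReal_iff_of_nonneg hr.le).1 h2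
  refine le_trans (modular_mono_ae hΩ hψ (ae_of_all _ fun x => ?_)) h1
  rw [enorm_smul, enorm_smul]
  gcongr
  rw [← ofReal_norm, ← ofReal_norm]
  refine ENNReal.ofReal_le_ofReal ?_
  rw [Real.norm_of_nonneg (inv_nonneg.2 hr.le), Real.norm_of_nonneg (inv_nonneg.2 (hr.trans h3).le)]
  exact inv_anti₀ hr h3.le

theorem luxNorm_le_of_modular_le_one {f : Vec n → F} {R : ℝ} (hR : 0 < R)
    (h : modular Ω ψ (fun x => R⁻¹ • f x) ≤ 1) : luxNorm Ω ψ f ≤ ENNReal.ofReal R :=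
  iInf_le_of_le R (iInf_le_of_le hR (iInf_le _ h))

theorem luxNorm_mono_ae (hΩ : MeasurableSet Ω) (hψ : ∀ x ∈ Ω, Monotone (ψ x))
    {f : Vec n → F} {g : Vec n → E} (h : ∀ᵐ x ∂volume.restrict Ω, ‖f x‖ₑ ≤ ‖g x‖ₑ) :
    luxNorm Ω ψ f ≤ luxNorm Ω ψ g := by
  refine le_iInf fun r => le_iInf fun hr => le_iInf fun h1 =>
    luxNorm_le_of_modular_le_one hr (le_trans (modular_mono_ae hΩ hψ ?_) h1)
  filter_upwards [h] with x hx
  rw [enorm_smul, enorm_smul]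
  gcongr

theorem luxNorm_smul_le {f : Vec n → F} {c : ℝ} (hc : c ≠ 0) :
    luxNorm Ω ψ (fun x => c • f x) ≤ ENNReal.ofReal |c| * luxNorm Ω ψ f := by
  have hc' : 0 < |c| := abs_pos.2 hc
  have hc0 : ENNReal.ofReal |c| ≠ 0 := by simpa using hc
  rw [mul_comm, ← ENNReal.div_le_iff hc0 ENNReal.ofReal_ne_top]
  refine le_iInf fun r => le_iInf fun hr => le_iInf fun h1 => ?_
  rw [ENNReal.div_le_iff hc0 ENNReal.ofReal_ne_top, ← ENNReal.ofReal_mul hr.le]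
  refine luxNorm_le_of_modular_le_one (by positivity) (le_of_eq_of_le ?_ h1)
  refine lintegral_congr fun x => ?_
  congr 1
  dsimp only
  rw [smul_smul, enorm_smul, enorm_smul]
  congr 1
  rw [← ofReal_norm, ← ofReal_norm, norm_mul, norm_inv, norm_inv, norm_mul, Real.norm_eq_abs,
    Real.norm_eq_abs, Real.norm_eq_abs, abs_abs]
  congr 1
  field_simp

/-- The Luxemburg norm of a convex `ψ` satisfies the triangle inequality, in modular form. -/
theorem modular_conj_add_le_one {φ : Vec n → ℝ≥0∞ → ℝ≥0∞} (hΩ : MeasurableSet Ω)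
    (hφ : IsWeakPhi Ω φ) {f g : Vec n → F} (hf : AEStronglyMeasurable f (volume.restrict Ω))
    {r s : ℝ} (hr : 0 < r) (hs : 0 < s) (h1 : modular Ω (conj φ) (fun x => r⁻¹ • f x) ≤ 1)
    (h2 : modular Ω (conj φ) (fun x => s⁻¹ • g x) ≤ 1) :
    modular Ω (conj φ) (fun x => (r + s)⁻¹ • (f x + g x)) ≤ 1 := by
  have hrs : 0 < r + s := by positivity
  set a := ENNReal.ofReal (r / (r + s)) with ha
  set b := ENNReal.ofReal (s / (r + s)) with hb
  have hab : a + b = 1 := by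
    rw [ha, hb, ← ENNReal.ofReal_add (by positivity) (by positivity), ← add_div,
      div_self hrs.ne', ENNReal.ofReal_one]
  calc modular Ω (conj φ) (fun x => (r + s)⁻¹ • (f x + g x))
      ≤ ∫⁻ x in Ω, a * conj φ x ‖r⁻¹ • f x‖ₑ + b * conj φ x ‖s⁻¹ • g x‖ₑ := by
        refine lintegral_mono fun x => le_trans (conj_mono x ?_) (conj_convex x hab _ _)
        have e : (r + s)⁻¹ • (f x + g x)
            = (r / (r + s)) • (r⁻¹ • f x) + (s / (r + s)) • (s⁻¹ • g x) := by
          rw [smul_smul, smul_smul, smul_add]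
          congr 2 <;> field_simp
        beta_reduce
        rw [e]
        refine (enorm_add_le _ _).trans (le_of_eq ?_)
        rw [enorm_smul (r / (r + s)), enorm_smul (s / (r + s)),
          Real.enorm_of_nonneg (by positivity), Real.enorm_of_nonneg (by positivity)]
    _ = a * modular Ω (conj φ) (fun x => r⁻¹ • f x)
        + b * modular Ω (conj φ) (fun x => s⁻¹ • g x) := by
        rw [lintegral_add_left', lintegral_const_mul' _ _ ENNReal.ofReal_ne_top,
          lintegral_const_mul' _ _ ENNReal.ofReal_ne_top]
        · rfl
        · exact (aemeasurable_conj hΩ hφ (hf.const_smul _).enorm).const_mul _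
    _ ≤ a * 1 + b * 1 := by gcongr
    _ = 1 := by rw [mul_one, mul_one, hab]

end LuxNorm

/-! ### Luxemburg norm versus associate norm -/

section Hoelder

variable {n : ℕ} {Ω : Set (Vec n)} {φ : Vec n → ℝ≥0∞ → ℝ≥0∞}
  {F : Type*} [NormedAddCommGroup F] {E : Type*} [NormedAddCommGroup E]

theorem lintegral_mul_le_two_of_modular_le_one (hφ : IsWeakPhi Ω φ)
    {f : Vec n → F} {g : Vec n → E} (hf : AEStronglyMeasurable f (volume.restrict Ω))
    (h1 : modular Ω φ f ≤ 1) (h2 : modular Ω (conj φ) g ≤ 1) :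
    ∫⁻ x in Ω, ‖f x‖ₑ * ‖g x‖ₑ ≤ 2 := by
  calc ∫⁻ x in Ω, ‖f x‖ₑ * ‖g x‖ₑ ≤ ∫⁻ x in Ω, φ x ‖f x‖ₑ + conj φ x ‖g x‖ₑ :=
        lintegral_mono fun x => mul_le_add_conj x ‖f x‖₊ _
    _ = modular Ω φ f + modular Ω (conj φ) g :=
        lintegral_add_left' (hφ.measurable_comp _ hf.enorm) _
    _ ≤ 1 + 1 := by gcongr
    _ = 2 := one_add_one_eq_two

theorem lintegral_enorm_mul_smul [NormedSpace ℝ F] [NormedSpace ℝ E] (f : Vec n → F) (g : Vec n → E) {a b : ℝ} (ha : 0 < a)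
    (hb : 0 < b) : ∫⁻ x in Ω, ‖f x‖ₑ * ‖g x‖ₑ
      = ENNReal.ofReal (a * b) * ∫⁻ x in Ω, ‖a⁻¹ • f x‖ₑ * ‖b⁻¹ • g x‖ₑ := by
  rw [← lintegral_const_mul' _ _ ENNReal.ofReal_ne_top]
  refine lintegral_congr fun x => ?_
  simp only [enorm_smul]
  rw [Real.enorm_of_nonneg (inv_nonneg.2 ha.le), Real.enorm_of_nonneg (inv_nonneg.2 hb.le)]
  have : ENNReal.ofReal (a * b) * (ENNReal.ofReal a⁻¹ * ENNReal.ofReal b⁻¹) = 1 := by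
    rw [← ENNReal.ofReal_mul (by positivity), ← ENNReal.ofReal_mul (by positivity)]
    rw [← ENNReal.ofReal_one]; congr 1; field_simp
  calc _ = 1 * (‖f x‖ₑ * ‖g x‖ₑ) := (one_mul _).symm
    _ = _ := by rw [← this]; ring

/-- Hölder's inequality. -/
theorem assocNorm_conj_le [NormedSpace ℝ F] (hΩ : MeasurableSet Ω) (hφ : IsWeakPhi Ω φ) {f : Vec n → F}
    (hf : AEStronglyMeasurable f (volume.restrict Ω)) :
    assocNorm Ω (conj φ) f ≤ 2 * luxNorm Ω φ f := by
  refine iSup_le fun g => iSup_le fun hg => iSup_le fun hg1 => ?_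
  rw [mul_comm, ← ENNReal.div_le_iff two_ne_zero ENNReal.ofNat_ne_top]
  refine le_iInf fun r => le_iInf fun hr => le_iInf fun h1 => ?_
  rw [ENNReal.div_le_iff two_ne_zero ENNReal.ofNat_ne_top]
  -- `‖g‖ ≤ 1` only controls the modular of `g / R` for `R > 1`; afterwards `R ↓ 1`.
  have key : ∀ R : ℝ, 1 < R → ∫⁻ x in Ω, ‖f x‖ₑ * ‖g x‖ₑ ≤ ENNReal.ofReal (r * R) * 2 := by
    intro R hR
    rw [lintegral_enorm_mul_smul f g hr (zero_lt_one.trans hR)]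
    gcongr
    refine lintegral_mul_le_two_of_modular_le_one hφ (hf.const_smul _) h1 ?_
    refine modular_le_one_of_luxNorm_lt hΩ (fun x _ => conj_mono x) (hg1.trans_lt ?_)
    rwa [← ENNReal.ofReal_one, ENNReal.ofReal_lt_ofReal_iff (zero_lt_one.trans hR)]
  have hlim : Tendsto (fun R : ℝ => ENNReal.ofReal (r * R) * 2) (𝓝[>] 1)
      (𝓝 (ENNReal.ofReal (r * 1) * 2)) := by
    refine Tendsto.mono_left ?_ nhdsWithin_le_nhds
    refine ENNReal.Tendsto.mul_const ?_ (Or.inr ENNReal.ofNat_ne_top)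
    exact ENNReal.tendsto_ofReal ((continuous_const.mul continuous_id).tendsto 1)
  rw [mul_one] at hlim
  refine ge_of_tendsto hlim ?_
  filter_upwards [self_mem_nhdsWithin] with R hR using key R hR

/-- Comparison with a small `s > 0` where `φ x s ≤ 1`. This finiteness is all that is taken from
(aDec). -/
theorem CondADec.lt_top (h : CondADec Ω φ) (hφ : IsWeakPhi Ω φ) {x : Vec n} (hx : x ∈ Ω)
    (t : ℝ≥0) : φ x t < ∞ := by
  obtain ⟨q, hq, L, -, h⟩ := h
  obtain ⟨s, hs, hs1⟩ := hφ.exists_nnreal_le hx one_pos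
  rcases le_or_gt t s with hts | hst
  · exact ((hφ.mono x hx (by exact_mod_cast hts)).trans hs1).trans_lt ENNReal.one_lt_top
  · have h1 := h x hx s t (by exact_mod_cast hs) (by exact_mod_cast hst.le) ENNReal.coe_lt_top
    have h2 : (L : ℝ≥0∞) * (φ x s / (s : ℝ≥0∞) ^ q) < ∞ := by
      refine ENNReal.mul_lt_top ENNReal.coe_lt_top (ENNReal.div_lt_top
        (hs1.trans_lt ENNReal.one_lt_top).ne ?_)
      exact (ENNReal.rpow_pos (by exact_mod_cast hs) ENNReal.coe_ne_top).ne'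
    have h3 := h1.trans_lt h2
    by_contra h4
    rw [not_lt, top_le_iff] at h4
    rw [h4, ENNReal.top_div_of_ne_top (ENNReal.rpow_ne_top_of_nonneg hq.le ENNReal.coe_ne_top)] at h3
    exact lt_irrefl _ h3

/-- With `L` the constant of almost monotonicity, `φ(x,t) / (L t)` is nearly a subgradient. -/
theorem conj_div_le {L : ℝ≥0} (hL : 1 ≤ L) {x : Vec n}
    (h : ∀ s t : ℝ≥0∞, 0 < s → s ≤ t → t < ∞ →
      φ x s / s ≤ L * (φ x t / t)) {t : ℝ≥0} (ht : 0 < t) :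
    conj φ x (φ x t / (L * t)) ≤ φ x t / L := by
  have hL0 : (L : ℝ≥0∞) ≠ 0 := by exact_mod_cast (zero_lt_one.trans_le hL).ne'
  have ht0 : (t : ℝ≥0∞) ≠ 0 := by exact_mod_cast ht.ne'
  have e : φ x t / (L * t) = φ x t / t / L := by
    rw [div_eq_mul_inv, div_eq_mul_inv, div_eq_mul_inv, ENNReal.mul_inv (Or.inl hL0)
      (Or.inl ENNReal.coe_ne_top)]
    ring
  refine conj_le_iff.2 fun s => ?_
  rw [e]
  -- For `s ≤ t` the left side is at most `φ x t / L`; for `s > t` almost monotonicity bounds it by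
  -- `φ x s`.
  rcases le_or_gt s t with hst | hts
  · refine le_trans ?_ le_add_self
    rw [← mul_div_assoc]
    gcongr
    rw [← mul_div_assoc]
    refine ENNReal.div_le_of_le_mul ?_
    rw [mul_comm (φ x t)]
    gcongr
  · refine le_trans ?_ le_self_add
    have h1 := h t s (by exact_mod_cast ht) (by exact_mod_cast hts.le) ENNReal.coe_lt_top
    calc (s : ℝ≥0∞) * (φ x t / t / L) ≤ s * (φ x s / s) := by
          exact mul_le_mul' le_rfl (ENNReal.div_le_of_le_mul (h1.trans_eq (mul_comm _ _)))
      _ ≤ φ x s := ENNReal.mul_div_le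

/-- The modular is controlled by the associate norm, for a truncation. -/
theorem setLIntegral_le_one_of_assocNorm_lt (hΩ : MeasurableSet Ω) (hφ : IsWeakPhi Ω φ)
    {L : ℝ≥0} (hL : 1 ≤ L) (hinc : ∀ x ∈ Ω, ∀ s t : ℝ≥0∞, 0 < s → s ≤ t → t < ∞ →
      φ x s / s ≤ L * (φ x t / t)) {f : Vec n → F}
    (hf : AEStronglyMeasurable f (volume.restrict Ω))
    (hN : assocNorm Ω (conj φ) f < (L : ℝ≥0∞)⁻¹) {p : Vec n → ℝ≥0∞} (hp : Measurable p)
    (hpf : p =ᵐ[volume.restrict Ω] fun x => φ x ‖f x‖ₑ) {S : Set (Vec n)} (hS : MeasurableSet S)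
    {j : ℝ≥0} (hSj : ∀ x ∈ S, p x ≤ j) (hfin : volume Ω < ∞) :
    ∫⁻ x in Ω, S.indicator p x ≤ 1 := by
  have hL0 : (L : ℝ≥0∞) ≠ 0 := by exact_mod_cast (zero_lt_one.trans_le hL).ne'
  set M := ∫⁻ x in Ω, S.indicator p x with hM
  have hMtop : M < ∞ := by
    calc M ≤ ∫⁻ x in Ω, j := by
          refine lintegral_mono fun x => ?_
          by_cases hx : x ∈ S
          · simpa [hx] using hSj x hx
          · simp [hx]
      _ < ∞ := by simpa using ENNReal.mul_lt_top ENNReal.coe_lt_top hfin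
  by_contra! hM1
  have hM0 : M ≠ 0 := (zero_lt_one.trans hM1).ne'
  -- With total mass `M > 1`, convexity and `conj_div_le` give `g` conjugate modular at most `1`,
  -- while `|f| |g|` integrates to at least `1 / L`, a contradiction. Where `f = 0` also `p = 0`,
  -- and the quotient is `0`.
  let g : Vec n → ℝ := fun x => (S.indicator p x / (L * ‖f x‖ₑ) / M).toReal
  have hgm : AEMeasurable g (volume.restrict Ω) :=
    (((hp.indicator hS).aemeasurable.div (hf.enorm.const_mul _)).div
      aemeasurable_const).ennreal_toReal
  have hpz : ∀ᵐ x ∂volume.restrict Ω, f x = 0 → p x = 0 := by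
    filter_upwards [hpf, ae_restrict_mem hΩ] with x hx hxΩ h0
    rw [hx, h0, enorm_zero, hφ.map_zero x hxΩ]
  have hg : ∀ᵐ x ∂volume.restrict Ω, ‖g x‖ₑ = M⁻¹ * (S.indicator p x / (L * ‖f x‖ₑ)) := by
    filter_upwards [hpz] with x hx
    rw [Real.enorm_of_nonneg ENNReal.toReal_nonneg, ENNReal.ofReal_toReal, div_eq_mul_inv _ M,
      mul_comm]
    refine ENNReal.div_ne_top ?_ hM0
    by_cases hxS : x ∈ S
    · rw [indicator_of_mem hxS]
      by_cases h0 : f x = 0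
      · simp [hx h0]
      · refine ENNReal.div_ne_top ((hSj x hxS).trans_lt ENNReal.coe_lt_top).ne ?_
        simp [hL0, h0]
    · simp [hxS]
  have hmod : modular Ω (conj φ) g ≤ 1 := by
    calc modular Ω (conj φ) g ≤ ∫⁻ x in Ω, M⁻¹ * S.indicator p x := by
          refine lintegral_mono_ae ?_
          filter_upwards [hg, hpf, hpz, ae_restrict_mem hΩ] with x h1 h2 h3 hxΩ
          rw [h1]
          refine (conj_mul_le x (ENNReal.inv_le_one.2 hM1.le) _).trans ?_
          gcongr
          by_cases hxS : x ∈ S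
          · rw [indicator_of_mem hxS]
            by_cases h0 : f x = 0
            · simp [h3 h0, conj_zero]
            · have := conj_div_le hL (hinc x hxΩ) (t := ‖f x‖₊)
                (by simpa using h0)
              rw [h2]
              refine this.trans ?_
              refine ENNReal.div_le_of_le_mul ?_
              calc φ x ‖f x‖₊ = φ x ‖f x‖ₑ * 1 := by rw [mul_one]; rfl
                _ ≤ _ := by gcongr; exact_mod_cast hL
          · simp [hxS, conj_zero]
      _ = 1 := by
        rw [lintegral_const_mul _ (hp.indicator hS), ENNReal.inv_mul_cancel hM0 hMtop.ne]
  have hgl : luxNorm Ω (conj φ) g ≤ 1 := by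
    have := luxNorm_le_of_modular_le_one (Ω := Ω) (ψ := conj φ) (f := g) one_pos
      (by simpa using hmod)
    simpa using this
  have h1 : ∫⁻ x in Ω, ‖f x‖ₑ * ‖g x‖ₑ ≤ assocNorm Ω (conj φ) f :=
    le_iSup_of_le g (le_iSup_of_le hgm (le_iSup_of_le hgl le_rfl))
  refine absurd (h1.trans_lt hN) (not_lt.2 ?_)
  calc (L : ℝ≥0∞)⁻¹ = ∫⁻ x in Ω, (L : ℝ≥0∞)⁻¹ * M⁻¹ * S.indicator p x := by
        rw [lintegral_const_mul _ (hp.indicator hS), mul_assoc,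
          ENNReal.inv_mul_cancel hM0 hMtop.ne, mul_one]
    _ ≤ _ := by
      refine lintegral_mono_ae ?_
      filter_upwards [hg, hpz] with x h1 h2
      rw [h1]
      by_cases h0 : f x = 0
      · by_cases hxS : x ∈ S <;> simp [hxS, h2 h0]
      · have e0 : ‖f x‖ₑ ≠ 0 := by simpa using h0
        rw [ENNReal.div_eq_inv_mul, ENNReal.mul_inv (Or.inl hL0) (Or.inl ENNReal.coe_ne_top)]
        calc _ = (‖f x‖ₑ * ‖f x‖ₑ⁻¹) * ((L : ℝ≥0∞)⁻¹ * M⁻¹ * S.indicator p x) := by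
              rw [ENNReal.mul_inv_cancel e0 enorm_ne_top, one_mul]
          _ ≤ _ := le_of_eq (by ring)

/-- Monotone convergence over the sublevel sets `{p ≤ j}`, which exhaust `Ω` up to a null set
because `φ` is finite at finite arguments. -/
theorem luxNorm_le_one_of_assocNorm_lt (hΩ : MeasurableSet Ω) (hφ : IsWeakPhi Ω φ)
    (hfinite : ∀ x ∈ Ω, ∀ t : ℝ≥0, φ x t < ∞)
    {L : ℝ≥0} (hL : 1 ≤ L) (hinc : ∀ x ∈ Ω, ∀ s t : ℝ≥0∞, 0 < s → s ≤ t → t < ∞ →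
      φ x s / s ≤ L * (φ x t / t)) {f : Vec n → F}
    (hf : AEStronglyMeasurable f (volume.restrict Ω))
    (hN : assocNorm Ω (conj φ) f < (L : ℝ≥0∞)⁻¹) (hfin : volume Ω < ∞) :
    modular Ω φ f ≤ 1 := by
  have hpm := hφ.measurable_comp _ hf.enorm
  obtain ⟨p, hp, hpf⟩ := hpm
  rw [modular, lintegral_congr_ae hpf]
  let S : ℕ → Set (Vec n) := fun j => {x | p x ≤ j}
  have hS : ∀ j, MeasurableSet (S j) := fun j => measurableSet_le hp measurable_const
  have hSm : Monotone S := fun i j hij x hx => le_trans (show p x ≤ i from hx) (by exact_mod_cast hij)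
  have hU : ∀ᵐ x ∂volume.restrict Ω, p x = ⨆ j, (S j).indicator p x := by
    filter_upwards [hpf, ae_restrict_mem hΩ] with x hx hxΩ
    have hlt : p x < ∞ := by rw [← hx]; exact hfinite x hxΩ ‖f x‖₊
    refine le_antisymm ?_ (iSup_le fun j => indicator_le_self _ _ _)
    obtain ⟨j, hj⟩ := ENNReal.exists_nat_gt hlt.ne
    refine le_iSup_of_le j ?_
    rw [indicator_of_mem (show x ∈ S j from hj.le)]
  rw [lintegral_congr_ae hU, lintegral_iSup (fun j => hp.indicator (hS j))]
  · exact iSup_le fun j => setLIntegral_le_one_of_assocNorm_lt hΩ hφ hL hinc hf hN hp hpf.symm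
      (hS j) (j := (j : ℝ≥0)) (fun x hx => hx.trans_eq (by simp)) hfin
  · intro i j hij x
    exact indicator_le_indicator_of_subset (hSm hij) (fun _ => zero_le) x

theorem assocNorm_smul_le [NormedSpace ℝ F] {ψ : Vec n → ℝ≥0∞ → ℝ≥0∞} {f : Vec n → F} (c : ℝ) :
    assocNorm Ω ψ (fun x => c • f x) ≤ ENNReal.ofReal |c| * assocNorm Ω ψ f := by
  refine iSup_le fun g => iSup_le fun hg => iSup_le fun hg1 => ?_
  have : ∫⁻ x in Ω, ‖c • f x‖ₑ * ‖g x‖ₑ = ENNReal.ofReal |c| * ∫⁻ x in Ω, ‖f x‖ₑ * ‖g x‖ₑ := by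
    rw [← lintegral_const_mul' _ _ ENNReal.ofReal_ne_top]
    refine lintegral_congr fun x => ?_
    rw [enorm_smul, ← ofReal_norm c, Real.norm_eq_abs, mul_assoc]
  rw [this]
  gcongr
  exact le_iSup_of_le g (le_iSup_of_le hg (le_iSup_of_le hg1 le_rfl))

/-- The Luxemburg quasinorm is dominated by the norm of the associate space of `L^{φ*}`. -/
theorem luxNorm_le_assocNorm [NormedSpace ℝ F] (hΩ : MeasurableSet Ω) (hφ : IsWeakPhi Ω φ)
    (hfinite : ∀ x ∈ Ω, ∀ t : ℝ≥0, φ x t < ∞)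
    {L : ℝ≥0} (hL : 1 ≤ L) (hinc : ∀ x ∈ Ω, ∀ s t : ℝ≥0∞, 0 < s → s ≤ t → t < ∞ →
      φ x s / s ≤ L * (φ x t / t)) {f : Vec n → F}
    (hf : AEStronglyMeasurable f (volume.restrict Ω)) (hfin : volume Ω < ∞) :
    luxNorm Ω φ f ≤ L * assocNorm Ω (conj φ) f := by
  have hL0 : (L : ℝ≥0∞) ≠ 0 := by exact_mod_cast (zero_lt_one.trans_le hL).ne'
  refine le_of_forall_gt_imp_ge_of_dense fun a ha => ?_
  rcases eq_or_ne a ∞ with rfl | hat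
  · exact le_top
  have ha0 : 0 < a := zero_le.trans_lt ha
  obtain ⟨r, rfl⟩ : ∃ r : ℝ≥0, (r : ℝ≥0∞) = a := ⟨a.toNNReal, ENNReal.coe_toNNReal hat⟩
  have hr : (0 : ℝ) < r := by exact_mod_cast ha0
  have h1 : assocNorm Ω (conj φ) (fun x => (r : ℝ)⁻¹ • f x) < (L : ℝ≥0∞)⁻¹ := by
    refine (assocNorm_smul_le _).trans_lt ?_
    rw [abs_of_nonneg (inv_nonneg.2 hr.le), ENNReal.ofReal_inv_of_pos hr, ENNReal.ofReal_coe_nnreal,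
      ← ENNReal.div_eq_inv_mul, ENNReal.div_lt_iff (Or.inl ha0.ne') (Or.inl hat),
      ← ENNReal.div_eq_inv_mul, ENNReal.lt_div_iff_mul_lt (Or.inl hL0) (Or.inl ENNReal.coe_ne_top),
      mul_comm]
    exact ha
  have h2 := luxNorm_le_one_of_assocNorm_lt hΩ hφ hfinite hL hinc (hf.const_smul _) h1 hfin
  exact (luxNorm_le_of_modular_le_one hr h2).trans_eq (by simp)

end Hoelder

/-! ### Mollification -/

section Mollifier

open scoped Convolution

variable {n : ℕ} {Ω : Set (Vec n)} {F : Type*} [NormedAddCommGroup F]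

theorem tsupport_subset_of_eq_zero {w : Vec n → F} {K : Set (Vec n)} (hKc : IsCompact K)
    (hK : ∀ x ∉ K, w x = 0) : tsupport w ⊆ K :=
  closure_minimal (Function.support_subset_iff'.2 hK) hKc.isClosed

theorem integrable_of_bounded_of_compact {w : Vec n → F} (hw : AEStronglyMeasurable w)
    {K : Set (Vec n)} (hKc : IsCompact K) (hK : ∀ x ∉ K, w x = 0) {M : ℝ} (hM : ∀ x, ‖w x‖ ≤ M) :
    Integrable w := by
  rw [← integrableOn_iff_integrable_of_support_subset
    (s := K) (fun x hx => by_contra fun h => hx (hK x h))]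
  exact Measure.integrableOn_of_bounded hKc.measure_lt_top.ne hw (ae_of_all _ hM)

variable [NormedSpace ℝ F]

/-- A bump function at the origin whose support is the closed ball of radius `1 / (k + 1)`. -/
def bump (n k : ℕ) : ContDiffBump (0 : Vec n) where
  rIn := 1 / (k + 1) / 2
  rOut := 1 / (k + 1)
  rIn_pos := by positivity
  rIn_lt_rOut := half_lt_self (by positivity)

/-- Mollification at scale `1 / (k + 1)`. -/
def mollify (k : ℕ) (w : Vec n → F) : Vec n → F :=
  (bump n k).normed volume ⋆[ContinuousLinearMap.lsmul ℝ ℝ, volume] w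

theorem tendsto_bump_rOut : Tendsto (fun k => (bump n k).rOut) atTop (𝓝 0) :=
  tendsto_one_div_add_atTop_nhds_zero_nat

theorem contDiff_mollify (k : ℕ) {w : Vec n → F} (hw : LocallyIntegrable w) :
    ContDiff ℝ (⊤ : ℕ∞) (mollify k w) :=
  HasCompactSupport.contDiff_convolution_left _ (bump n k).hasCompactSupport_normed
    (bump n k).contDiff_normed hw

theorem norm_mollify_le [CompleteSpace F] (k : ℕ) {w : Vec n → F} (hw : AEStronglyMeasurable w) {x : Vec n} {M : ℝ}
    (hM : 0 ≤ M) (h : ∀ y, dist y x < 1 / (k + 1) → ‖w y‖ ≤ M) : ‖mollify k w x‖ ≤ M := by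
  rw [← dist_zero_right]
  refine dist_convolution_le hM (bump n k).support_normed_eq.subset (bump n k).nonneg_normed
    (bump n k).integral_normed hw fun y hy => ?_
  rw [dist_zero_right]
  exact h y hy

theorem mollify_eq_zero [CompleteSpace F] (k : ℕ) {w : Vec n → F} (hw : AEStronglyMeasurable w) {K : Set (Vec n)}
    (hK : ∀ x ∉ K, w x = 0) {δ : ℝ} (hδ : 1 / ((k : ℝ) + 1) ≤ δ) {x : Vec n}
    (hx : x ∉ Metric.cthickening δ K) : mollify k w x = 0 := by
  refine norm_le_zero_iff.1 (norm_mollify_le k hw le_rfl fun y hy => ?_)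
  rw [hK y, norm_zero]
  intro hyK
  refine hx (Metric.mem_cthickening_of_dist_le x y δ K hyK ?_)
  rw [dist_comm]
  exact hy.le.trans hδ

theorem ae_tendsto_mollify [CompleteSpace F] {w : Vec n → F} (hw : LocallyIntegrable w) :
    ∀ᵐ x, Tendsto (fun k => mollify k w x) atTop (𝓝 (w x)) :=
  -- The fixed ratio `2` of outer to inner radius is what the Lebesgue differentiation argument
  -- needs.
  ContDiffBump.ae_convolution_tendsto_right_of_locallyIntegrable (K := 2) tendsto_bump_rOut
    (Eventually.of_forall fun k => by simp only [bump]; linarith) hw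

theorem eventually_one_div_le {δ : ℝ} (hδ : 0 < δ) : ∀ᶠ k : ℕ in atTop, 1 / ((k : ℝ) + 1) ≤ δ :=
  tendsto_one_div_add_atTop_nhds_zero_nat.eventually_le_const hδ

/-- Mollification of a bounded function supported in a compact subset of `Ω`. -/
theorem exists_mollify_support [CompleteSpace F] (hΩ : IsOpen Ω) {w : Vec n → F} (hw : AEStronglyMeasurable w)
    {K : Set (Vec n)} (hKc : IsCompact K) (hKΩ : K ⊆ Ω) (hK : ∀ x ∉ K, w x = 0) :
    ∃ K' : Set (Vec n), IsCompact K' ∧ K' ⊆ Ω ∧ ∀ᶠ k in atTop, ∀ x ∉ K', mollify k w x = 0 := by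
  obtain ⟨δ, hδ, h⟩ := hKc.exists_cthickening_subset_open hΩ hKΩ
  refine ⟨_, hKc.cthickening, h, ?_⟩
  filter_upwards [eventually_one_div_le hδ] with k hk x hx
  exact mollify_eq_zero k hw hK hk hx

theorem isTestField_of_eq_zero {w : Vec n → F} (hw : ContDiff ℝ 1 w) {K : Set (Vec n)}
    (hKc : IsCompact K) (hKΩ : K ⊆ Ω) (hK : ∀ x ∉ K, w x = 0) : IsTestField Ω w where
  contDiff := hw
  hasCompactSupport := HasCompactSupport.intro hKc hK
  tsupport_subset := (tsupport_subset_of_eq_zero hKc hK).trans hKΩ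

end Mollifier

/-! ### Integration by parts against `C¹` test fields -/

section IntegrationByParts

variable {n : ℕ} {Ω : Set (Vec n)} {F : Type*} [NormedAddCommGroup F] [InnerProductSpace ℝ F]

theorem integrable_inner_of_bounded {G w : Vec n → F} (hG : LocallyIntegrableOn G Ω)
    {K : Set (Vec n)} (hKc : IsCompact K) (hKΩ : K ⊆ Ω)
    (hw : AEStronglyMeasurable w (volume.restrict Ω)) {M : ℝ} (hM : ∀ x, ‖w x‖ ≤ M)
    (hK : ∀ x ∉ K, w x = 0) : Integrable (fun x => inner ℝ (G x) (w x)) (volume.restrict Ω) := by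
  have hGK : IntegrableOn G K := hG.integrableOn_compact_subset hKΩ hKc
  have hb : Integrable (K.indicator fun x => ‖G x‖ * M) (volume.restrict Ω) :=
    ((integrable_indicator_iff hKc.measurableSet).2 (hGK.norm.mul_const M)).restrict
  refine hb.mono' (hG.aestronglyMeasurable.inner hw) (ae_of_all _ fun x => ?_)
  by_cases hx : x ∈ K
  · rw [indicator_of_mem hx]
    exact (norm_inner_le_norm _ _).trans (by gcongr; exact hM x)
  · simp [hx, hK x hx]

/-- Passage to the limit against a locally integrable function. -/
theorem tendsto_setIntegral_inner {G w : Vec n → F} {v : ℕ → Vec n → F}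
    (hG : LocallyIntegrableOn G Ω) {K : Set (Vec n)} (hKc : IsCompact K) (hKΩ : K ⊆ Ω)
    (hv : ∀ k, AEStronglyMeasurable (v k) (volume.restrict Ω)) {M : ℝ}
    (hM : ∀ k x, ‖v k x‖ ≤ M) (hK : ∀ᶠ k in atTop, ∀ x ∉ K, v k x = 0)
    (hlim : ∀ᵐ x ∂volume.restrict Ω, Tendsto (fun k => v k x) atTop (𝓝 (w x))) :
    Tendsto (fun k => ∫ x in Ω, inner ℝ (G x) (v k x)) atTop
      (𝓝 (∫ x in Ω, inner ℝ (G x) (w x))) := by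
  have hGK : IntegrableOn G K := hG.integrableOn_compact_subset hKΩ hKc
  refine tendsto_integral_filter_of_dominated_convergence (K.indicator fun x => ‖G x‖ * M)
    (Eventually.of_forall fun k => hG.aestronglyMeasurable.inner (hv k)) ?_
    ((integrable_indicator_iff hKc.measurableSet).2 (hGK.norm.mul_const M)).restrict ?_
  · filter_upwards [hK] with k hk
    refine ae_of_all _ fun x => ?_
    by_cases hx : x ∈ K
    · rw [indicator_of_mem hx]
      exact (norm_inner_le_norm _ _).trans (by gcongr; exact hM k x)
    · simp [hx, hk x hx]
  · filter_upwards [hlim] with x hx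
    exact tendsto_const_nhds.inner hx

theorem continuous_partialDeriv {η : Vec n → ℝ} (h : ContDiff ℝ 1 η) (i : Fin n) :
    Continuous (partialDeriv i η) :=
  (h.continuous_fderiv one_ne_zero).clm_apply continuous_const

theorem partialDeriv_mollify {η : Vec n → ℝ} (h : ContDiff ℝ 1 η) (hc : HasCompactSupport η)
    (k : ℕ) (i : Fin n) : partialDeriv i (mollify k η) = mollify k (partialDeriv i η) := by
  ext x
  have hl : LocallyIntegrable ((bump n k).normed volume) :=
    (bump n k).continuous_normed.locallyIntegrable
  have h1 := hc.hasFDerivAt_convolution_right (μ := volume) (ContinuousLinearMap.lsmul ℝ ℝ)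
    hl h x
  rw [partialDeriv, mollify, h1.fderiv,
    convolution_precompR_apply _ hl (hc.fderiv ℝ) (h.continuous_fderiv one_ne_zero)]
  rfl

theorem tendsto_setIntegral_mul_mollify (hΩ : IsOpen Ω) {f η : Vec n → ℝ}
    (hf : LocallyIntegrableOn f Ω) (hη : Continuous η) (hc : HasCompactSupport η)
    (hs : tsupport η ⊆ Ω) :
    Tendsto (fun k => ∫ x in Ω, f x * mollify k η x) atTop (𝓝 (∫ x in Ω, f x * η x)) := by
  obtain ⟨M, hM⟩ := hc.exists_bound_of_continuous hη
  have hz : ∀ x ∉ tsupport η, η x = 0 := fun x hx => image_eq_zero_of_notMem_tsupport hx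
  obtain ⟨K', hK'c, hK'Ω, hK'⟩ := exists_mollify_support hΩ hη.aestronglyMeasurable hc hs hz
  have hli : LocallyIntegrable η := hη.locallyIntegrable
  have := tendsto_setIntegral_inner (v := fun k => mollify k η) hf hK'c hK'Ω
    (fun k => (contDiff_mollify k hli).continuous.aestronglyMeasurable)
    (fun k x => norm_mollify_le k hη.aestronglyMeasurable ((norm_nonneg _).trans (hM x))
      fun y _ => hM y) hK' (ae_restrict_of_ae (ae_tendsto_mollify hli))
  simpa only [real_inner_eq_re_inner, RCLike.inner_apply, conj_trivial, RCLike.re_to_real,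
    mul_comm] using this

theorem LocallyIntegrableOn.pi_apply {ι : Type*} [Fintype ι] {E : ι → Type*}
    [∀ i, NormedAddCommGroup (E i)] [∀ i, NormedSpace ℝ (E i)] {u : Vec n → PiLp 2 E}
    (hu : LocallyIntegrableOn u Ω) (i : ι) : LocallyIntegrableOn (fun x => u x i) Ω :=
  (PiLp.proj 2 E i : PiLp 2 E →L[ℝ] E i).locallyIntegrableOn_comp hu

/-- The integration by parts formula extends from smooth to `C¹` test functions. -/
theorem HasWeakGradient.integral_eq_of_contDiff_one {m : ℕ} (hΩ : IsOpen Ω) {u : Vec n → Vec m}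
    {G : Vec n → Mat m n} (h : HasWeakGradient Ω u G) {η : Vec n → ℝ} (hη : IsTestField Ω η)
    (α : Fin m) (i : Fin n) :
    ∫ x in Ω, u x α * partialDeriv i η x = - ∫ x in Ω, G x α i * η x := by
  obtain ⟨hη1, hηc, hηs⟩ := hη
  have hli : LocallyIntegrable η := hη1.continuous.locallyIntegrable
  have hz : ∀ x ∉ tsupport η, η x = 0 := fun x hx => image_eq_zero_of_notMem_tsupport hx
  obtain ⟨K', hK'c, hK'Ω, hK'⟩ :=
    exists_mollify_support hΩ hη1.continuous.aestronglyMeasurable hηc hηs hz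
  have hd : HasCompactSupport (partialDeriv i η) :=
    (hηc.fderiv ℝ).comp_left (g := fun L : Vec n →L[ℝ] ℝ => L (EuclideanSpace.single i 1)) rfl
  have hds : tsupport (partialDeriv i η) ⊆ Ω := by
    refine subset_trans ?_ ((tsupport_fderiv_subset ℝ).trans hηs)
    refine closure_mono fun x hx h0 => hx ?_
    rw [partialDeriv, h0]; rfl
  have t1 := tendsto_setIntegral_mul_mollify hΩ (LocallyIntegrableOn.pi_apply h.locallyIntegrable α)
    (continuous_partialDeriv hη1 i) hd hds
  have t2 := (tendsto_setIntegral_mul_mollify hΩ (LocallyIntegrableOn.pi_apply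
    (LocallyIntegrableOn.pi_apply h.locallyIntegrable_grad α) i) hη1.continuous hηc hηs).neg
  refine tendsto_nhds_unique t1 (t2.congr' ?_)
  filter_upwards [hK'] with k hk
  have hcs : HasCompactSupport (mollify k η) := HasCompactSupport.intro hK'c hk
  have := h.integral_eq (mollify k η) (contDiff_mollify k hli) hcs
    ((tsupport_subset_of_eq_zero hK'c hk).trans hK'Ω) α i
  rw [← this, partialDeriv_mollify hη1 hηc]

theorem IsTestField.clm_comp {E : Type*} [NormedAddCommGroup E] [NormedSpace ℝ E]
    {w : Vec n → F} (hw : IsTestField Ω w) (L : F →L[ℝ] E) : IsTestField Ω (fun x => L (w x)) where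
  contDiff := L.contDiff.comp hw.contDiff
  hasCompactSupport := hw.hasCompactSupport.comp_left (map_zero L)
  tsupport_subset := (tsupport_comp_subset (map_zero L) w).trans hw.tsupport_subset

/-- From here on `u` enters only through its gradient `G`. -/
theorem HasWeakGradient.sum_integral_mul_divergence {m : ℕ} (hΩ : IsOpen Ω) {u : Vec n → Vec m}
    {G : Vec n → Mat m n} (h : HasWeakGradient Ω u G) {w : Vec n → Mat m n}
    (hw : IsTestField Ω w) :
    ∑ α : Fin m, ∫ x in Ω, u x α * divergence (fun y => w y α) x
      = - ∫ x in Ω, inner ℝ (G x) (w x) := by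
  have hwc : ∀ α i, IsTestField Ω (fun x => w x α i) := fun α i =>
    hw.clm_comp ((PiLp.proj 2 (fun _ : Fin n => ℝ) i : Vec n →L[ℝ] ℝ).comp
      (PiLp.proj 2 (fun _ : Fin m => Vec n) α : Mat m n →L[ℝ] Vec n))
  have hint : ∀ (f g : Vec n → ℝ), LocallyIntegrableOn f Ω → Continuous g → HasCompactSupport g →
      tsupport g ⊆ Ω → Integrable (fun x => f x * g x) (volume.restrict Ω) := by
    intro f g hf hg hc hs
    obtain ⟨M, hM⟩ := hc.exists_bound_of_continuous hg
    have := integrable_inner_of_bounded hf hc hs hg.aestronglyMeasurable hM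
      (fun x hx => image_eq_zero_of_notMem_tsupport hx)
    simpa only [real_inner_eq_re_inner, RCLike.inner_apply, conj_trivial, RCLike.re_to_real,
      mul_comm] using this
  have hu := fun α => LocallyIntegrableOn.pi_apply h.locallyIntegrable α
  have hG := fun α i => LocallyIntegrableOn.pi_apply
    (LocallyIntegrableOn.pi_apply h.locallyIntegrable_grad α) i
  have e1 : ∀ α, ∫ x in Ω, u x α * divergence (fun y => w y α) x
      = ∑ i, - ∫ x in Ω, G x α i * w x α i := by
    intro α
    simp only [divergence, Finset.mul_sum]
    rw [integral_finsetSum]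
    · exact Finset.sum_congr rfl fun i _ => h.integral_eq_of_contDiff_one hΩ (hwc α i) α i
    · intro i _
      have hd : HasCompactSupport (partialDeriv i fun x => w x α i) :=
        ((hwc α i).hasCompactSupport.fderiv ℝ).comp_left
          (g := fun L : Vec n →L[ℝ] ℝ => L (EuclideanSpace.single i 1)) rfl
      refine hint _ _ (hu α) (continuous_partialDeriv (hwc α i).contDiff i) hd ?_
      refine subset_trans ?_ ((tsupport_fderiv_subset ℝ).trans (hwc α i).tsupport_subset)
      refine closure_mono fun x hx h0 => hx ?_
      rw [partialDeriv, h0]; rfl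
  have hGw : ∀ α i, Integrable (fun x => G x α i * w x α i) (volume.restrict Ω) := fun α i =>
    hint _ _ (hG α i) (hwc α i).contDiff.continuous (hwc α i).hasCompactSupport
      (hwc α i).tsupport_subset
  have e2 : ∀ x, inner ℝ (G x) (w x) = ∑ α, ∑ i, G x α i * w x α i := by
    intro x
    simp only [PiLp.inner_apply, RCLike.inner_apply, conj_trivial, mul_comm]
  simp only [e1, e2]
  rw [integral_finsetSum _ fun α _ => integrable_finsetSum _ fun i _ => hGw α i,
    ← Finset.sum_neg_distrib]
  refine Finset.sum_congr rfl fun α _ => ?_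
  rw [integral_finsetSum _ fun i _ => hGw α i, ← Finset.sum_neg_distrib]

end IntegrationByParts

/-! ### The dual norm and the associate norm -/

section Duality

variable {n m : ℕ} {Ω : Set (Vec n)} {φ : Vec n → ℝ≥0∞ → ℝ≥0∞}

theorem ofReal_integral_inner_le {F : Type*} [NormedAddCommGroup F] [InnerProductSpace ℝ F]
    (G w : Vec n → F) :
    ENNReal.ofReal (∫ x in Ω, inner ℝ (G x) (w x)) ≤ ∫⁻ x in Ω, ‖G x‖ₑ * ‖w x‖ₑ := by
  calc ENNReal.ofReal (∫ x in Ω, inner ℝ (G x) (w x))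
      ≤ ‖∫ x in Ω, inner ℝ (G x) (w x)‖ₑ := by
        rw [← ofReal_norm]
        exact ENNReal.ofReal_le_ofReal (le_abs_self _)
    _ ≤ ∫⁻ x in Ω, ‖(inner ℝ (G x) (w x) : ℝ)‖ₑ := enorm_integral_le_lintegral_enorm _
    _ ≤ _ := lintegral_mono fun x => by
        rw [← ofReal_norm, ← ofReal_norm, ← ofReal_norm, ← ENNReal.ofReal_mul (norm_nonneg _)]
        exact ENNReal.ofReal_le_ofReal (norm_inner_le_norm _ _)

/-- Cauchy–Schwarz, with `g = ‖w‖` as competitor in the associate norm. -/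
theorem dualNorm_le_assocNorm (hΩ : IsOpen Ω) {u : Vec n → Vec m} {G : Vec n → Mat m n}
    (h : HasWeakGradient Ω u G) : dualNorm Ω φ u ≤ assocNorm Ω (conj φ) G := by
  refine iSup_le fun w => iSup_le fun hw => iSup_le fun hw1 => ?_
  rw [h.sum_integral_mul_divergence hΩ hw, ← integral_neg]
  simp only [← inner_neg_right]
  refine (ofReal_integral_inner_le _ _).trans ?_
  refine le_iSup_of_le (fun x => ‖w x‖) (le_iSup_of_le ?_ (le_iSup_of_le ?_ ?_))
  · exact hw.contDiff.continuous.norm.aemeasurable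
  · refine (luxNorm_mono_ae hΩ.measurableSet (fun x _ => conj_mono x) ?_).trans hw1
    exact ae_of_all _ fun x => by simp
  · exact lintegral_mono fun x => by simp

theorem ofReal_integral_inner_le_mul_dualNorm (hΩ : IsOpen Ω) {u : Vec n → Vec m}
    {G : Vec n → Mat m n} (h : HasWeakGradient Ω u G) {z : Vec n → Mat m n}
    (hz : IsTestField Ω z) {R : ℝ} (hR : 0 < R)
    (hzR : luxNorm Ω (conj φ) z ≤ ENNReal.ofReal R) :
    ENNReal.ofReal (∫ x in Ω, inner ℝ (G x) (z x)) ≤ ENNReal.ofReal R * dualNorm Ω φ u := by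
  -- The minus sign cancels the one from integration by parts.
  have hw : IsTestField Ω (fun x => (-R⁻¹) • z x) :=
    hz.clm_comp ((-R⁻¹) • ContinuousLinearMap.id ℝ (Mat m n))
  have hw1 : luxNorm Ω (conj φ) (fun x => (-R⁻¹) • z x) ≤ 1 := by
    refine (luxNorm_smul_le (neg_ne_zero.2 (inv_ne_zero hR.ne'))).trans ?_
    rw [abs_neg, abs_of_pos (inv_pos.2 hR)]
    calc _ ≤ ENNReal.ofReal R⁻¹ * ENNReal.ofReal R := by gcongr
      _ = 1 := by
        rw [← ENNReal.ofReal_mul (inv_pos.2 hR).le, inv_mul_cancel₀ hR.ne', ENNReal.ofReal_one]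
  have h1 : ENNReal.ofReal (∑ α : Fin m, ∫ x in Ω, u x α *
      divergence (fun y => ((-R⁻¹) • z y) α) x) ≤ dualNorm Ω φ u :=
    le_iSup_of_le _ (le_iSup_of_le hw (le_iSup_of_le hw1 le_rfl))
  rw [h.sum_integral_mul_divergence hΩ hw] at h1
  simp only [inner_smul_right, integral_const_mul] at h1
  rw [neg_mul, neg_neg] at h1
  calc ENNReal.ofReal (∫ x in Ω, inner ℝ (G x) (z x))
      = ENNReal.ofReal R * ENNReal.ofReal (R⁻¹ * ∫ x in Ω, inner ℝ (G x) (z x)) := by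
        rw [← ENNReal.ofReal_mul hR.le, mul_inv_cancel_left₀ hR.ne']
    _ ≤ _ := by gcongr

/-- The associate norm is determined by bounded fields supported in compact subsets of `Ω`. -/
theorem assocNorm_le_of_forall_bounded {F : Type*} [NormedAddCommGroup F] [InnerProductSpace ℝ F]
    (hΩ : IsOpen Ω) (hΩb : Bornology.IsBounded Ω) {ψ : Vec n → ℝ≥0∞ → ℝ≥0∞}
    (hψ : ∀ x ∈ Ω, Monotone (ψ x)) {G : Vec n → F} (hG : LocallyIntegrableOn G Ω) {B : ℝ≥0∞}
    (h : ∀ (w : Vec n → F) (K : Set (Vec n)) (M : ℝ), StronglyMeasurable w → IsCompact K → K ⊆ Ω →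
      (∀ x, ‖w x‖ ≤ M) → (∀ x ∉ K, w x = 0) → luxNorm Ω ψ w ≤ 1 →
      ENNReal.ofReal (∫ x in Ω, inner ℝ (G x) (w x)) ≤ B) :
    assocNorm Ω ψ G ≤ B := by
  refine iSup_le fun g => iSup_le fun hg => iSup_le fun hg1 => ?_
  obtain ⟨g', hg'm, hgg'⟩ := hg
  obtain ⟨G', hG'm, hGG'⟩ := hG.aestronglyMeasurable
  obtain ⟨T, hTc, hTΩ, hTU, hTm⟩ := hΩ.exists_iUnion_isClosed
  -- The closed sets `T j` exhaust `Ω` and are compact since `Ω` is bounded; `S j` also caps `|g'|`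
  -- at `j`.
  let S : ℕ → Set (Vec n) := fun j => T j ∩ {x | |g' x| ≤ j}
  have hSm : Monotone S := fun i j hij =>
    inter_subset_inter (hTm hij) fun x (hx : |g' x| ≤ i) => hx.trans (by exact_mod_cast hij)
  have hSmeas : ∀ j, MeasurableSet (S j) := fun j =>
    (hTc j).measurableSet.inter (measurableSet_le (measurable_norm.comp hg'm) measurable_const)
  have hSU : ⋃ j, S j = Ω := by
    refine subset_antisymm (iUnion_subset fun j => inter_subset_left.trans (hTΩ j)) fun x hx => ?_
    rw [← hTU] at hx
    obtain ⟨i, hi⟩ := mem_iUnion.1 hx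
    obtain ⟨j, hj⟩ := exists_nat_ge |g' x|
    refine mem_iUnion.2 ⟨max i j, hTm (le_max_left i j) hi, ?_⟩
    exact hj.trans (by exact_mod_cast le_max_right i j)
  have hSΩ : ∀ j, S j ⊆ Ω := fun j => inter_subset_left.trans (hTΩ j)
  have e : ∫⁻ x in Ω, ‖G x‖ₑ * ‖g x‖ₑ = ⨆ j, ∫⁻ x in S j, ‖G x‖ₑ * ‖g x‖ₑ := by
    conv_lhs => rw [← hSU]
    exact setLIntegral_iUnion_of_directed _ hSm.directed_le
  rw [e]
  refine iSup_le fun j => ?_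
  -- Length `|g'|` in the direction of `G'`, so that `⟨G, w⟩ = |G| |g|` a.e. on `S j`; where `G' =
  -- 0` the field vanishes.
  let w : Vec n → F := (S j).indicator fun x => (|g' x| / ‖G' x‖) • G' x
  have hwm : StronglyMeasurable w :=
    (((measurable_norm.comp hg'm).div hG'm.norm.measurable).stronglyMeasurable.smul
      hG'm).indicator (hSmeas j)
  have hKc : IsCompact (T j) :=
    Metric.isCompact_of_isClosed_isBounded (hTc j) (hΩb.subset (hTΩ j))
  have hwg : ∀ x, ‖w x‖ ≤ |g' x| := by
    intro x
    refine (norm_indicator_le_norm_self _ _).trans ?_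
    rw [norm_smul, Real.norm_of_nonneg (by positivity)]
    rcases eq_or_ne ‖G' x‖ 0 with h0 | h0
    · simp [h0]
    · rw [div_mul_cancel₀ _ h0]
  have hwj : ∀ x, ‖w x‖ ≤ j := by
    intro x
    by_cases hx : x ∈ S j
    · exact (hwg x).trans hx.2
    · simp [w, hx]
  have hw0 : ∀ x ∉ T j, w x = 0 := fun x hx =>
    indicator_of_notMem (fun h => hx h.1) _
  have hlux : luxNorm Ω ψ w ≤ 1 := by
    refine (luxNorm_mono_ae hΩ.measurableSet hψ ?_).trans hg1
    filter_upwards [hgg'] with x hx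
    rw [hx, enorm_le_iff_norm_le]
    exact hwg x
  refine le_trans (le_of_eq ?_) (h w (T j) j hwm hKc (hTΩ j) hwj hw0 hlux)
  have hinner : (fun x => inner ℝ (G x) (w x)) =ᵐ[volume.restrict Ω]
      (S j).indicator fun x => ‖G x‖ * ‖g x‖ := by
    filter_upwards [hgg', hGG'] with x h1 h2
    by_cases hx : x ∈ S j
    · simp only [w, indicator_of_mem hx, h1, h2, inner_smul_right, real_inner_self_eq_norm_sq,
        Real.norm_eq_abs]
      by_cases h0 : ‖G' x‖ = 0
      · simp [h0]
      · field_simp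
    · simp [w, hx]
  have hi := integrable_inner_of_bounded hG hKc (hTΩ j) hwm.aestronglyMeasurable hwj hw0
  rw [ofReal_integral_eq_lintegral_ofReal hi, lintegral_congr_ae (show (fun x =>
    ENNReal.ofReal (inner ℝ (G x) (w x))) =ᵐ[volume.restrict Ω] fun x => ENNReal.ofReal
      ((S j).indicator (fun x => ‖G x‖ * ‖g x‖) x) from hinner.fun_comp ENNReal.ofReal)]
  · have : ∀ x, ENNReal.ofReal ((S j).indicator (fun x => ‖G x‖ * ‖g x‖) x)
        = (S j).indicator (fun x => ‖G x‖ₑ * ‖g x‖ₑ) x := by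
      intro x
      by_cases hx : x ∈ S j
      · simp only [indicator_of_mem hx]
        rw [ENNReal.ofReal_mul (norm_nonneg _), ofReal_norm, ofReal_norm]
      · simp [hx]
    simp only [this]
    rw [lintegral_indicator (hSmeas j), Measure.restrict_restrict (hSmeas j),
      inter_eq_left.2 (hSΩ j)]
  · filter_upwards [hinner] with x hx
    rw [hx]
    exact indicator_nonneg (fun _ _ => by positivity) x

end Duality

/-! ### Equality when test fields are dense -/

section Density

variable {n m : ℕ} {Ω : Set (Vec n)} {φ : Vec n → ℝ≥0∞ → ℝ≥0∞}
  {F : Type*} [NormedAddCommGroup F] [NormedSpace ℝ F]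

/-- Fast convergence to zero in `L^{φ*}` implies convergence almost everywhere. -/
theorem ae_tendsto_zero_of_luxNorm_lt (hΩ : MeasurableSet Ω) (hφ : IsWeakPhi Ω φ)
    {d : ℕ → Vec n → F} (hd : ∀ k, AEStronglyMeasurable (d k) (volume.restrict Ω))
    (h : ∀ k, luxNorm Ω (conj φ) (d k) < ENNReal.ofReal ((1 / 4) ^ k)) :
    ∀ᵐ x ∂volume.restrict Ω, Tendsto (fun k => d k x) atTop (𝓝 0) := by
  have hmeas : ∀ k, AEMeasurable (fun x => conj φ x ‖(2 : ℝ) ^ k • d k x‖ₑ) (volume.restrict Ω) :=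
    fun k => aemeasurable_conj hΩ hφ ((hd k).const_smul _).enorm
  -- Half of the rate `4^{-k}` is spent: by convexity `2^k d_k` has modular at most `2^{-k}`, which
  -- is summable.
  have hle : ∀ k, ∫⁻ x in Ω, conj φ x ‖(2 : ℝ) ^ k • d k x‖ₑ ≤ (2⁻¹) ^ k := by
    intro k
    have h1 := modular_le_one_of_luxNorm_lt hΩ (fun x _ => conj_mono x) (h k)
    have h2 : ∀ x, conj φ x ‖(2 : ℝ) ^ k • d k x‖ₑ
        ≤ (2⁻¹ : ℝ≥0∞) ^ k * conj φ x ‖((1 / 4 : ℝ) ^ k)⁻¹ • d k x‖ₑ := by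
      intro x
      have e : (2 : ℝ) ^ k • d k x = ((2 : ℝ)⁻¹ ^ k) • (((1 / 4 : ℝ) ^ k)⁻¹ • d k x) := by
        rw [smul_smul, ← inv_pow, ← mul_pow]
        norm_num
      rw [e, enorm_smul, Real.enorm_of_nonneg (by positivity), ENNReal.ofReal_pow (by positivity),
        ENNReal.ofReal_inv_of_pos two_pos, ENNReal.ofReal_ofNat]
      exact conj_mul_le x (pow_le_one₀ zero_le (ENNReal.inv_le_one.2 one_le_two)) _
    calc _ ≤ ∫⁻ x in Ω, (2⁻¹ : ℝ≥0∞) ^ k * conj φ x ‖((1 / 4 : ℝ) ^ k)⁻¹ • d k x‖ₑ :=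
          lintegral_mono h2
      _ = (2⁻¹ : ℝ≥0∞) ^ k * modular Ω (conj φ) (fun x => ((1 / 4 : ℝ) ^ k)⁻¹ • d k x) :=
          lintegral_const_mul' _ _ (by simp)
      _ ≤ (2⁻¹ : ℝ≥0∞) ^ k * 1 := by gcongr
      _ = _ := mul_one _
  have hsum : ∫⁻ x in Ω, ∑' k, conj φ x ‖(2 : ℝ) ^ k • d k x‖ₑ ≠ ∞ := by
    rw [lintegral_tsum hmeas]
    refine ((ENNReal.tsum_le_tsum hle).trans_lt ?_).ne
    rw [ENNReal.tsum_geometric, ENNReal.one_sub_inv_two, inv_inv]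
    exact ENNReal.ofNat_lt_top
  filter_upwards [ae_lt_top' (AEMeasurable.tsum hmeas) hsum, ae_restrict_mem hΩ] with x hx hxΩ
  have h0 := ENNReal.tendsto_atTop_zero_of_tsum_ne_top hx.ne
  obtain ⟨s, hs, hs1⟩ := hφ.exists_nnreal_le hxΩ one_pos
  rw [tendsto_zero_iff_norm_tendsto_zero]
  have hb : Tendsto (fun k : ℕ => (2 / (s : ℝ)) * (1 / 2) ^ k) atTop (𝓝 0) := by
    simpa using (tendsto_pow_atTop_nhds_zero_of_lt_one (by norm_num : (0 : ℝ) ≤ 1 / 2)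
      (by norm_num)).const_mul (2 / (s : ℝ))
  refine squeeze_zero' (Eventually.of_forall fun k => norm_nonneg _) ?_ hb
  filter_upwards [h0.eventually_le_const one_pos] with k hk
  -- Young's inequality at a point `s` with `φ x s ≤ 1` turns the modular bound into `‖d k x‖ ≤ (2 /
  -- s) 2^{-k}`.
  have h1 : (s : ℝ≥0∞) * ‖(2 : ℝ) ^ k • d k x‖ₑ ≤ 2 := by
    exact (mul_le_add_conj (φ := φ) x s _).trans ((add_le_add hs1 hk).trans_eq one_add_one_eq_two)
  have h2 : (s : ℝ) * (2 ^ k * ‖d k x‖) ≤ 2 := by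
    have h3 : ENNReal.ofReal ((s : ℝ) * ‖(2 : ℝ) ^ k • d k x‖) ≤ ENNReal.ofReal 2 := by
      rw [ENNReal.ofReal_mul s.coe_nonneg, ofReal_norm, ENNReal.ofReal_coe_nnreal, ENNReal.ofReal_ofNat]
      exact h1
    have h4 := (ENNReal.ofReal_le_ofReal_iff two_pos.le).1 h3
    rwa [norm_smul, Real.norm_of_nonneg (by positivity)] at h4
  have hs' : (0 : ℝ) < s := hs
  rw [one_div, inv_pow, ← div_eq_mul_inv, div_div, le_div_iff₀ (by positivity)]
  linarith

/-- A `C¹`, bounded, Lipschitz map which is the identity on a given ball. -/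
theorem exists_smooth_truncation {F : Type*} [NormedAddCommGroup F] [InnerProductSpace ℝ F]
    [FiniteDimensional ℝ F] {M : ℝ} (hM : 0 < M) :
    ∃ (T : F → F) (A : ℝ) (C : ℝ≥0), ContDiff ℝ 1 T ∧ (∀ y, ‖T y‖ ≤ A) ∧ LipschitzWith C T ∧
      ∀ y, ‖y‖ ≤ M → T y = y := by
  let b : ContDiffBump (0 : F) := ⟨M, 2 * M, hM, by linarith⟩
  have hc : ContDiff ℝ 1 fun y => b y • y := b.contDiff.smul contDiff_id
  have hs : HasCompactSupport fun y => b y • y := b.hasCompactSupport.smul_right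
  obtain ⟨C, hC⟩ := hc.lipschitzWith_of_hasCompactSupport hs one_ne_zero
  obtain ⟨A, hA⟩ := hs.exists_bound_of_continuous hc.continuous
  refine ⟨_, A, C, hc, hA, hC, fun y hy => ?_⟩
  rw [b.one_of_mem_closedBall (by simpa using hy), one_smul]

/-- Mollify the indicator of a `δ`-thickening of `K` at a scale at most `δ`: the averaging ball
around a point of `K` stays in the thickening. -/
theorem exists_smooth_cutoff (hΩ : IsOpen Ω) {K : Set (Vec n)} (hKc : IsCompact K)
    (hKΩ : K ⊆ Ω) : ∃ χ : Vec n → ℝ, ContDiff ℝ 1 χ ∧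
      (HasCompactSupport χ ∧ tsupport χ ⊆ Ω) ∧ (∀ x, ‖χ x‖ ≤ 1) ∧ ∀ x ∈ K, χ x = 1 := by
  obtain ⟨δ, hδ, hKδ⟩ := hKc.exists_cthickening_subset_open hΩ hKΩ
  have hc : IsCompact (Metric.cthickening δ K) := hKc.cthickening
  let f : Vec n → ℝ := (Metric.cthickening δ K).indicator 1
  have hfm : AEStronglyMeasurable f :=
    (stronglyMeasurable_one.indicator hc.measurableSet).aestronglyMeasurable
  have hf0 : ∀ x ∉ Metric.cthickening δ K, f x = 0 := fun x hx => indicator_of_notMem hx _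
  have hf1 : ∀ x, ‖f x‖ ≤ 1 := fun x =>
    (norm_indicator_le_norm_self _ _).trans (by simp)
  obtain ⟨K', hK'c, hK'Ω, hK'⟩ := exists_mollify_support hΩ hfm hc hKδ hf0
  obtain ⟨k, hk, hkδ⟩ := (hK'.and (eventually_one_div_le hδ)).exists
  have hli : LocallyIntegrable f := (integrable_of_bounded_of_compact hfm hc hf0 hf1).locallyIntegrable
  refine ⟨mollify k f, (contDiff_mollify k hli).of_le (by exact_mod_cast le_top),
    ⟨HasCompactSupport.intro hK'c hk, (tsupport_subset_of_eq_zero hK'c hk).trans hK'Ω⟩,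
    fun x => norm_mollify_le k hfm zero_le_one fun y _ => hf1 y, fun x hx => ?_⟩
  have hfx : ∀ y, dist y x ≤ δ → f y = 1 := fun y hy =>
    indicator_of_mem (Metric.mem_cthickening_of_dist_le y x δ K hx hy) _
  have hx1 : f x = 1 := hfx x (by simpa using hδ.le)
  rw [← hx1]
  refine (bump n k).normed_convolution_eq_right fun y hy => ?_
  rw [hx1, hfx y (le_trans (le_of_lt hy) hkδ)]

theorem assocNorm_le_dualNorm_of_dense (hΩ : IsOpen Ω) (hΩb : Bornology.IsBounded Ω)
    (hφ : IsWeakPhi Ω φ) (hdense : TestFieldsDense m Ω (conj φ)) {u : Vec n → Vec m}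
    {G : Vec n → Mat m n} (h : HasWeakGradient Ω u G) :
    assocNorm Ω (conj φ) G ≤ dualNorm Ω φ u := by
  refine assocNorm_le_of_forall_bounded hΩ hΩb (fun x _ => conj_mono x) h.locallyIntegrable_grad
    fun w K M hwm hKc hKΩ hM hK hw1 => ?_
  have hmem : MemOrlicz Ω (conj φ) w := by
    refine ⟨hwm.aestronglyMeasurable, 2⁻¹, by norm_num, ?_⟩
    refine (modular_le_one_of_luxNorm_lt hΩ.measurableSet (fun x _ => conj_mono x)
      (hw1.trans_lt ?_)).trans_lt ENNReal.one_lt_top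
    simp
  have hex : ∀ k : ℕ, ∃ v : Vec n → Mat m n, IsTestField Ω v ∧
      luxNorm Ω (conj φ) (fun x => v x - w x) < ENNReal.ofReal ((1 / 4) ^ k) :=
    fun k => hdense w hmem _ (by simp)
  choose v hv hvw using hex
  have hlim := ae_tendsto_zero_of_luxNorm_lt hΩ.measurableSet hφ
    (fun k => (hv k).contDiff.continuous.aestronglyMeasurable.sub hwm.aestronglyMeasurable) hvw
  obtain ⟨T, A, C, hT, hTA, hTC, hTid⟩ :=
    exists_smooth_truncation (F := Mat m n) (M := max M 1) (by positivity)
  have hTw : ∀ x, T (w x) = w x := fun x => hTid _ ((hM x).trans (le_max_left _ _))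
  have hT0 : T 0 = 0 := hTid 0 (by simp)
  have hA : 0 ≤ A := (norm_nonneg _).trans (hTA 0)
  obtain ⟨χ, hχc, hχs, hχr, hχK⟩ : ∃ χ : Vec n → ℝ, ContDiff ℝ 1 χ ∧
      (HasCompactSupport χ ∧ tsupport χ ⊆ Ω) ∧ (∀ x, ‖χ x‖ ≤ 1) ∧ ∀ x ∈ K, χ x = 1 :=
    exists_smooth_cutoff hΩ hKc hKΩ
  -- `T` and `χ` both fix `w`, so `|z k - w| ≤ C |v k - w|` pointwise.
  let z : ℕ → Vec n → Mat m n := fun k x => χ x • T (v k x)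
  have hz0 : ∀ k, ∀ x ∉ tsupport χ, z k x = 0 := fun k x hx => by
    simp only [z, image_eq_zero_of_notMem_tsupport hx, zero_smul]
  have hz : ∀ k, IsTestField Ω (z k) := fun k =>
    isTestField_of_eq_zero (hχc.smul (hT.comp (hv k).contDiff)) hχs.1 hχs.2 (hz0 k)
  have hχw : ∀ x, χ x • w x = w x := fun x => by
    by_cases hx : x ∈ K
    · rw [hχK x hx, one_smul]
    · rw [hK x hx, smul_zero]
  have hzw : ∀ k x, ‖z k x - w x‖ ≤ C * ‖v k x - w x‖ := by
    intro k x
    have e : z k x - w x = χ x • (T (v k x) - T (w x)) := by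
      rw [smul_sub, hTw, hχw]
    rw [e, norm_smul]
    refine (mul_le_of_le_one_left (norm_nonneg _) (hχr x)).trans ?_
    simpa only [dist_eq_norm] using hTC.dist_le_mul (v k x) (w x)
  have hzA : ∀ k x, ‖z k x‖ ≤ A := by
    intro k x
    rw [norm_smul]
    exact (mul_le_of_le_one_left (norm_nonneg _) (hχr x)).trans (hTA _)
  have hzlim : ∀ᵐ x ∂volume.restrict Ω, Tendsto (fun k => z k x) atTop (𝓝 (w x)) := by
    filter_upwards [hlim] with x hx
    rw [tendsto_iff_norm_sub_tendsto_zero]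
    refine squeeze_zero (fun k => norm_nonneg _) (fun k => hzw k x) ?_
    simpa using hx.norm.const_mul (C : ℝ)
  have hconv := tendsto_setIntegral_inner h.locallyIntegrable_grad hχs.1 hχs.2
    (fun k => (hz k).contDiff.continuous.aestronglyMeasurable) hzA
    (Eventually.of_forall hz0) hzlim
  -- Triangle inequality for `w + (z k - w)`; `C + 1` replaces `C` to keep the second radius
  -- positive. The bound tends to `1`.
  have hnorm : ∀ k : ℕ, luxNorm Ω (conj φ) (z k)
      ≤ ENNReal.ofReal ((1 + (1 / 4) ^ k) + (C + 1) * (1 / 4) ^ k) := by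
    intro k
    have p1 : (0 : ℝ) < 1 + (1 / 4) ^ k := by positivity
    have p2 : (0 : ℝ) < (C + 1) * (1 / 4) ^ k := by positivity
    refine luxNorm_le_of_modular_le_one (by positivity) ?_
    have h1 : modular Ω (conj φ) (fun x => (1 + (1 / 4) ^ k : ℝ)⁻¹ • w x) ≤ 1 := by
      refine modular_le_one_of_luxNorm_lt hΩ.measurableSet (fun x _ => conj_mono x)
        (hw1.trans_lt ?_)
      rw [← ENNReal.ofReal_one, ENNReal.ofReal_lt_ofReal_iff p1]
      linarith [show (0 : ℝ) < (1 / 4) ^ k by positivity]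
    have h2 : modular Ω (conj φ) (fun x => ((C + 1) * (1 / 4) ^ k : ℝ)⁻¹ • (z k x - w x)) ≤ 1 := by
      refine (modular_mono_ae hΩ.measurableSet (fun x _ => conj_mono x) (ae_of_all _ fun x => ?_)).trans
        (modular_le_one_of_luxNorm_lt hΩ.measurableSet (fun x _ => conj_mono x) (hvw k))
      rw [enorm_le_iff_norm_le, norm_smul, norm_smul, Real.norm_of_nonneg (by positivity),
        Real.norm_of_nonneg (by positivity), mul_inv, mul_comm _ ((1 / 4 : ℝ) ^ k)⁻¹, mul_assoc]
      gcongr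
      rw [inv_mul_le_iff₀ (by positivity)]
      exact (hzw k x).trans (by gcongr; linarith)
    have := modular_conj_add_le_one hΩ.measurableSet hφ hwm.aestronglyMeasurable p1 p2 h1 h2
    simpa only [add_sub_cancel] using this
  have hbound := fun k => ofReal_integral_inner_le_mul_dualNorm (φ := φ) hΩ h (hz k)
    (show (0 : ℝ) < (1 + (1 / 4) ^ k) + (C + 1) * (1 / 4) ^ k by positivity) (hnorm k)
  rcases eq_or_ne (dualNorm Ω φ u) ∞ with hV | hV
  · rw [hV]; exact le_top
  have hr : Tendsto (fun k : ℕ => (1 + (1 / 4 : ℝ) ^ k) + (C + 1) * (1 / 4) ^ k) atTop (𝓝 1) := by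
    have h4 : Tendsto (fun k : ℕ => (1 / 4 : ℝ) ^ k) atTop (𝓝 0) :=
      tendsto_pow_atTop_nhds_zero_of_lt_one (by norm_num) (by norm_num)
    simpa using (h4.const_add 1).add (h4.const_mul ((C : ℝ) + 1))
  have hr' := ENNReal.Tendsto.mul_const (ENNReal.tendsto_ofReal hr) (Or.inr hV)
  rw [ENNReal.ofReal_one, one_mul] at hr'
  exact le_of_tendsto_of_tendsto' (ENNReal.tendsto_ofReal hconv) hr' hbound

end Density

/-! ### Condition (A1) and boundedness of mollification -/

section Jensen

variable {n m : ℕ} {Ω : Set (Vec n)} {φ : Vec n → ℝ≥0∞ → ℝ≥0∞}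

/-- Halve `s` until `φ x` first drops to `R` or below. This replaces solving `φ x s₀ = R`, which may
fail since `φ x` can jump. -/
theorem IsWeakPhi.exists_dyadic (hφ : IsWeakPhi Ω φ) {x : Vec n} (hx : x ∈ Ω) {R : ℝ≥0∞}
    (hR : 0 < R) {s : ℝ≥0} (hs : R < φ x s) :
    ∃ s₀ : ℝ≥0, 0 < s₀ ∧ 2 * s₀ ≤ s ∧ φ x s₀ ≤ R ∧ R < φ x (2 * s₀ : ℝ≥0) := by
  have hs0 : 0 < s := by
    rcases eq_or_ne s 0 with rfl | h
    · rw [ENNReal.coe_zero, hφ.map_zero x hx] at hs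
      exact absurd hs not_lt_zero
    · exact pos_iff_ne_zero.2 h
  have hex : ∃ j : ℕ, φ x (s / 2 ^ j : ℝ≥0) ≤ R := by
    obtain ⟨s₁, hs₁, h1⟩ := hφ.exists_nnreal_le hx hR
    obtain ⟨j, hj⟩ := pow_unbounded_of_one_lt (s / s₁) one_lt_two
    refine ⟨j, le_trans (hφ.mono x hx ?_) h1⟩
    rw [ENNReal.coe_le_coe, div_le_iff₀ (by positivity)]
    rw [div_lt_iff₀ hs₁] at hj
    rw [mul_comm]
    exact hj.le
  classical
  have hj0 : Nat.find hex ≠ 0 := by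
    intro h0
    have := Nat.find_spec hex
    rw [h0, pow_zero, div_one] at this
    exact absurd hs (not_lt.2 this)
  obtain ⟨i, hi⟩ := Nat.exists_eq_succ_of_ne_zero hj0
  have h1 := Nat.find_spec hex
  have h2 : R < φ x (s / 2 ^ i : ℝ≥0) :=
    not_le.1 (Nat.find_min hex (by rw [hi]; exact Nat.lt_succ_self i))
  rw [hi, Nat.succ_eq_add_one] at h1
  have e : 2 * (s / 2 ^ (i + 1)) = s / 2 ^ i := by
    rw [pow_succ]; field_simp
  refine ⟨s / 2 ^ (i + 1), by positivity, ?_, h1, by rwa [e]⟩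
  rw [e]
  exact div_le_self zero_le (one_le_pow₀ one_le_two)

/-- A Jensen-type inequality for the conjugate of a weak `Φ`-function with (A1). -/
theorem conj_lintegral_le (hΩ : MeasurableSet Ω) (hφ : IsWeakPhi Ω φ) {L β C₀ : ℝ≥0}
    (hL : 1 ≤ L) (hinc : ∀ x ∈ Ω, ∀ s t : ℝ≥0∞, 0 < s → s ≤ t → t < ∞ →
      φ x s / s ≤ L * (φ x t / t))
    (hA1 : ∀ x ∈ Ω, ∀ y ∈ Ω, ∀ t : ℝ≥0∞, φ y t ≤ 1 / edist x y ^ n → φ x (β * t) ≤ φ y t + 1)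
    {x : Vec n} (hx : x ∈ Ω) {R : ℝ≥0∞} (hR1 : 1 ≤ R) {κ : Vec n → ℝ≥0∞}
    (hκm : Measurable κ) (hκ1 : ∫⁻ y, κ y ≤ 1) (hκR : ∀ y, κ y ≤ C₀ * R)
    (hκs : ∀ y, κ y ≠ 0 → R ≤ 1 / edist y x ^ n) {f : Vec n → ℝ≥0∞}
    (hf : AEMeasurable f (volume.restrict Ω)) (hf1 : ∫⁻ y in Ω, conj φ y (f y) ≤ 1) :
    conj φ x ((β / (2 * L * (2 + C₀)) : ℝ≥0) * ∫⁻ y in Ω, κ y * f y)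
      ≤ 1 + ∫⁻ y in Ω, κ y * conj φ y (f y) := by
  set A := ∫⁻ y in Ω, κ y * f y with hA
  set J := ∫⁻ y in Ω, κ y * conj φ y (f y) with hJ
  set D : ℝ≥0 := 2 * L * (2 + C₀) with hD
  have hD1 : 1 ≤ D := by
    calc (1 : ℝ≥0) ≤ 2 * 1 * (2 + 0) := by norm_num
      _ ≤ D := by rw [hD]; gcongr; exact zero_le
  have hD0 : D ≠ 0 := (zero_lt_one.trans_le hD1).ne'
  -- While `φ x s ≤ R`, (A1) gives `φ y (β s) ≤ φ x s + 1` wherever `κ y ≠ 0`; Young's inequality at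
  -- `y` is then averaged against `κ`.
  have hlow : ∀ s : ℝ≥0, φ x s ≤ R → (s : ℝ≥0∞) * (β * A) ≤ φ x s + (1 + J) := by
    intro s hs
    calc (s : ℝ≥0∞) * (β * A) = ((β * s : ℝ≥0) : ℝ≥0∞) * A := by
          rw [ENNReal.coe_mul]; ring
      _ = ∫⁻ y in Ω, ((β * s : ℝ≥0) : ℝ≥0∞) * (κ y * f y) :=
          (lintegral_const_mul' _ _ ENNReal.coe_ne_top).symm
      _ ≤ ∫⁻ y in Ω, (κ y * (φ x s + 1) + κ y * conj φ y (f y)) := by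
          refine setLIntegral_mono' hΩ fun y hy => ?_
          rcases eq_or_ne (κ y) 0 with h0 | h0
          · simp [h0]
          · have h1 := hA1 y hy x hx s (hs.trans (hκs y h0))
            calc ((β * s : ℝ≥0) : ℝ≥0∞) * (κ y * f y)
                = κ y * (((β * s : ℝ≥0) : ℝ≥0∞) * f y) := by ring
              _ ≤ κ y * (φ y (β * s : ℝ≥0) + conj φ y (f y)) := by
                  gcongr; exact mul_le_add_conj y _ _
              _ ≤ κ y * ((φ x s + 1) + conj φ y (f y)) := by
                  gcongr; rw [ENNReal.coe_mul]; exact h1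
              _ = _ := mul_add _ _ _
      _ = (∫⁻ y in Ω, κ y) * (φ x s + 1) + J := by
          rw [lintegral_add_left (hκm.mul_const _), lintegral_mul_const _ hκm]
      _ ≤ 1 * (φ x s + 1) + J := by
          gcongr
          exact (setLIntegral_le_lintegral _ _).trans hκ1
      _ = _ := by rw [one_mul, add_assoc]
  refine conj_le_iff.2 fun s => ?_
  rcases le_or_gt (φ x s) R with hs | hs
  · refine le_trans ?_ (hlow s hs)
    gcongr
    exact div_le_self zero_le hD1
  -- For large `s`, the low range at `s₀` and `J ≤ C₀ R` give `s₀ β A ≤ (2 + C₀) R`, and almost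
  -- monotonicity from `2 s₀` to `s` gives `s R ≤ 2 L s₀ φ x s`. The product of the constants is
  -- `D`.
  · obtain ⟨s₀, hs₀, h2s, h1, h2⟩ := hφ.exists_dyadic hx (zero_lt_one.trans_le hR1) hs
    refine le_trans ?_ le_self_add
    have hJR : J ≤ C₀ * R := by
      calc J ≤ ∫⁻ y in Ω, (C₀ * R) * conj φ y (f y) := by
            refine lintegral_mono fun y => ?_
            gcongr
            exact hκR y
        _ = (C₀ * R) * ∫⁻ y in Ω, conj φ y (f y) :=
            lintegral_const_mul'' _ (aemeasurable_conj hΩ hφ hf)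
        _ ≤ (C₀ * R) * 1 := by gcongr
        _ = _ := mul_one _
    have h3 : (s₀ : ℝ≥0∞) * (β * A) ≤ (2 + C₀) * R := by
      calc (s₀ : ℝ≥0∞) * (β * A) ≤ φ x s₀ + (1 + J) := hlow s₀ h1
        _ ≤ R + (R + C₀ * R) := by gcongr
        _ = _ := by ring
    have h20 : ((2 * s₀ : ℝ≥0) : ℝ≥0∞) ≠ 0 := by
      exact_mod_cast (by positivity : (0 : ℝ≥0) < 2 * s₀).ne'
    have h4 := hinc x hx (2 * s₀ : ℝ≥0) s (pos_iff_ne_zero.2 h20) (by exact_mod_cast h2s)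
      ENNReal.coe_lt_top
    rw [ENNReal.div_le_iff h20 ENNReal.coe_ne_top] at h4
    have h5 : (s : ℝ≥0∞) * R ≤ L * (2 * s₀ : ℝ≥0) * φ x s := by
      calc (s : ℝ≥0∞) * R ≤ s * (L * (φ x s / s) * (2 * s₀ : ℝ≥0)) := by
            gcongr; exact h2.le.trans h4
        _ = L * (2 * s₀ : ℝ≥0) * (s * (φ x s / s)) := by ring
        _ ≤ _ := by gcongr; exact ENNReal.mul_div_le
    have hsD : ((s₀ * D : ℝ≥0) : ℝ≥0∞) ≠ 0 := by
      exact_mod_cast (mul_pos hs₀ (pos_iff_ne_zero.2 hD0)).ne'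
    rw [← ENNReal.mul_le_mul_iff_right hsD ENNReal.coe_ne_top]
    calc ((s₀ * D : ℝ≥0) : ℝ≥0∞) * (s * ((β / D : ℝ≥0) * A))
        = s * (s₀ * (((D * (β / D) : ℝ≥0) : ℝ≥0∞) * A)) := by push_cast; ring
      _ = s * (s₀ * (β * A)) := by rw [mul_div_cancel₀ _ hD0]
      _ ≤ s * ((2 + C₀) * R) := by gcongr
      _ = (2 + C₀) * (s * R) := by ring
      _ ≤ (2 + C₀) * (L * (2 * s₀ : ℝ≥0) * φ x s) := by gcongr
      _ = _ := by rw [hD]; push_cast; ring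

theorem lintegral_bump (k : ℕ) : ∫⁻ y, ENNReal.ofReal ((bump n k).normed volume y) = 1 := by
  rw [← ofReal_integral_eq_lintegral_ofReal (bump n k).integrable_normed
    (ae_of_all _ (bump n k).nonneg_normed), (bump n k).integral_normed, ENNReal.ofReal_one]

/-- The kernel is at most the inverse volume of its inner ball, of radius `1 / (2 (k + 1))`. With `R
= (k + 1) ^ n` this is the bound `κ ≤ C₀ R` of the Jensen inequality. -/
theorem exists_bump_le (n : ℕ) : ∃ C₀ : ℝ≥0, ∀ k (y : Vec n),
    ENNReal.ofReal ((bump n k).normed volume y) ≤ C₀ * ((k + 1 : ℕ) : ℝ≥0∞) ^ n := by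
  have hω : 0 < volume.real (Metric.closedBall (0 : Vec n) 1) :=
    ENNReal.toReal_pos (Metric.measure_closedBall_pos _ _ one_pos).ne'
      measure_closedBall_lt_top.ne
  refine ⟨(2 ^ n / volume.real (Metric.closedBall (0 : Vec n) 1)).toNNReal, fun k y => ?_⟩
  have h := (bump n k).normed_le_div_measure_closedBall_rIn volume y
  rw [Measure.addHaar_real_closedBall' _ _ (bump n k).rIn_pos.le] at h
  have e : (((2 ^ n / volume.real (Metric.closedBall (0 : Vec n) 1)).toNNReal : ℝ≥0) : ℝ≥0∞)
      * ((k + 1 : ℕ) : ℝ≥0∞) ^ n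
      = ENNReal.ofReal (2 ^ n / volume.real (Metric.closedBall (0 : Vec n) 1) * (k + 1) ^ n) := by
    rw [ENNReal.ofReal_mul (by positivity), ENNReal.ofReal_pow (by positivity)]
    congr 2
    rw [← Nat.cast_succ, ENNReal.ofReal_natCast]
  rw [e]
  refine ENNReal.ofReal_le_ofReal (h.trans (le_of_eq ?_))
  simp only [bump, finrank_euclideanSpace, Fintype.card_fin]
  have hp : ((1 : ℝ) / (k + 1) / 2) ^ n * (2 ^ n * (k + 1) ^ n) = 1 := by
    rw [← mul_pow, ← mul_pow]
    convert! one_pow n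
    field_simp
  have hp0 : ((1 : ℝ) / (k + 1) / 2) ^ n ≠ 0 := by positivity
  rw [div_mul_eq_mul_div, div_eq_div_iff (mul_ne_zero hp0 hω.ne') hω.ne', one_mul, ← mul_assoc,
    mul_comm (2 ^ n * _) (_ ^ n), hp, one_mul]

theorem pow_le_one_div_edist_pow {k : ℕ} {x y : Vec n}
    (h : ENNReal.ofReal ((bump n k).normed volume (x - y)) ≠ 0) :
    ((k + 1 : ℕ) : ℝ≥0∞) ^ n ≤ 1 / edist y x ^ n := by
  have h1 : x - y ∈ Metric.ball (0 : Vec n) (bump n k).rOut := by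
    rw [← (bump n k).support_normed_eq (μ := volume), Function.mem_support]
    intro h0
    exact h (by rw [h0, ENNReal.ofReal_zero])
  rw [mem_ball_zero_iff] at h1
  have h2 : edist y x ≤ ((k + 1 : ℕ) : ℝ≥0∞)⁻¹ := by
    rw [edist_comm, edist_dist, dist_eq_norm]
    refine (ENNReal.ofReal_le_ofReal h1.le).trans (le_of_eq ?_)
    have : (bump n k).rOut = ((k + 1 : ℕ) : ℝ)⁻¹ := by simp [bump]
    rw [this, ENNReal.ofReal_inv_of_pos (by positivity), ENNReal.ofReal_natCast]
  rw [one_div, ENNReal.inv_pow]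
  gcongr
  rw [← ENNReal.inv_le_inv, inv_inv]
  exact h2

theorem lintegral_lintegral_bump_le {h : Vec n → ℝ≥0∞}
    (hh : AEMeasurable h (volume.restrict Ω)) (k : ℕ) :
    ∫⁻ x in Ω, ∫⁻ y in Ω, ENNReal.ofReal ((bump n k).normed volume (x - y)) * h y
      ≤ ∫⁻ y in Ω, h y := by
  have hm : Measurable fun y : Vec n => ENNReal.ofReal ((bump n k).normed volume y) :=
    (bump n k).continuous_normed.measurable.ennreal_ofReal
  rw [lintegral_lintegral_swap]
  · refine lintegral_mono fun y => ?_
    rw [lintegral_mul_const (f := fun x => ENNReal.ofReal ((bump n k).normed volume (x - y))) _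
      (hm.comp (measurable_id.sub_const y))]
    refine mul_le_of_le_one_left zero_le ((setLIntegral_le_lintegral _ _).trans ?_)
    rw [lintegral_sub_right_eq_self (fun z => ENNReal.ofReal ((bump n k).normed volume z)) y,
      lintegral_bump]
  · exact (hm.comp (measurable_fst.sub measurable_snd)).aemeasurable.mul hh.comp_snd

theorem enorm_mollify_le {F : Type*} [NormedAddCommGroup F] [NormedSpace ℝ F] (k : ℕ)
    {w : Vec n → F} (hΩ : MeasurableSet Ω) (hw : ∀ x ∉ Ω, w x = 0) (x : Vec n) :
    ‖mollify k w x‖ₑ ≤ ∫⁻ y in Ω, ENNReal.ofReal ((bump n k).normed volume (x - y)) * ‖w y‖ₑ := by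
  rw [mollify, convolution_lsmul_swap]
  refine (enorm_integral_le_lintegral_enorm _).trans (le_of_eq ?_)
  rw [← lintegral_indicator hΩ]
  refine lintegral_congr fun y => ?_
  by_cases hy : y ∈ Ω
  · rw [indicator_of_mem hy, enorm_smul, Real.enorm_of_nonneg ((bump n k).nonneg_normed _)]
  · simp [hy, hw y hy]

/-- Under (A1), mollification is uniformly bounded on `L^{φ*}`. -/
theorem exists_luxNorm_mollify_le (hΩ : MeasurableSet Ω) (hfin : volume Ω < ∞)
    (hφ : IsWeakPhi Ω φ) (hA1 : CondA1 Ω φ) (F : Type*) [NormedAddCommGroup F]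
    [NormedSpace ℝ F] :
    ∃ Q : ℝ, 0 < Q ∧ ∀ (w : Vec n → F) (k : ℕ), AEStronglyMeasurable w (volume.restrict Ω) →
      (∀ x ∉ Ω, w x = 0) → luxNorm Ω (conj φ) w ≤ 1 →
      luxNorm Ω (conj φ) (mollify k w) ≤ ENNReal.ofReal Q := by
  obtain ⟨L, hL, hinc⟩ := hφ.almostIncreasing
  obtain ⟨β, hβ, -, hA1⟩ := hA1 1 one_pos
  obtain ⟨C₀, hC₀⟩ := exists_bump_le n
  set c : ℝ≥0 := β / (2 * L * (2 + C₀)) with hc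
  have hc0 : 0 < c := by have := zero_lt_one.trans_le hL; positivity
  -- The Jensen bound `1 + ∫ κ φ*` integrates over `Ω` to at most `|Ω| + 1`; convexity absorbs this
  -- factor.
  set W : ℝ := (volume Ω).toReal + 1 with hW
  have hW1 : 1 ≤ W := le_add_of_nonneg_left ENNReal.toReal_nonneg
  have hWe : ENNReal.ofReal W = volume Ω + 1 := by
    rw [hW, ENNReal.ofReal_add ENNReal.toReal_nonneg zero_le_one, ENNReal.ofReal_toReal hfin.ne,
      ENNReal.ofReal_one]
  have hc0' : (0 : ℝ) < c := hc0
  -- `2` makes the modular of `w / 2` at most `1`, `c` is the Jensen constant, and `W` normalises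
  -- the total.
  refine ⟨2 * W / c, by positivity, fun w k hwm hw0 hw1 => ?_⟩
  have hmod : modular Ω (conj φ) (fun x => (2 : ℝ)⁻¹ • w x) ≤ 1 := by
    refine modular_le_one_of_luxNorm_lt hΩ (fun x _ => conj_mono x) (hw1.trans_lt ?_)
    rw [← ENNReal.ofReal_one, ENNReal.ofReal_lt_ofReal_iff two_pos]
    exact one_lt_two
  have hfm : AEMeasurable (fun y => ‖(2 : ℝ)⁻¹ • w y‖ₑ) (volume.restrict Ω) :=
    (hwm.const_smul _).enorm
  have hkm : ∀ x, Measurable fun y : Vec n =>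
      ENNReal.ofReal ((bump n k).normed volume (x - y)) := fun x =>
    ((bump n k).continuous_normed.measurable.comp (measurable_id.const_sub x)).ennreal_ofReal
  have hk1 : ∀ x : Vec n, ∫⁻ y, ENNReal.ofReal ((bump n k).normed volume (x - y)) ≤ 1 := fun x => by
    rw [lintegral_sub_left_eq_self (fun z => ENNReal.ofReal ((bump n k).normed volume z)) x,
      lintegral_bump]
  refine luxNorm_le_of_modular_le_one (by positivity) ?_
  have hpt : ∀ x ∈ Ω, conj φ x ‖(2 * W / c)⁻¹ • mollify k w x‖ₑ ≤ (ENNReal.ofReal W)⁻¹ *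
      (1 + ∫⁻ y in Ω, ENNReal.ofReal ((bump n k).normed volume (x - y)) *
        conj φ y ‖(2 : ℝ)⁻¹ • w y‖ₑ) := by
    intro x hx
    have hJ := conj_lintegral_le hΩ hφ hL hinc hA1 hx (R := ((k + 1 : ℕ) : ℝ≥0∞) ^ n)
      (one_le_pow₀ (by exact_mod_cast Nat.succ_pos k)) (hkm x) (hk1 x) (fun y => hC₀ k (x - y))
      (fun y => pow_le_one_div_edist_pow) hfm hmod
    have hle : ‖(2 * W / c)⁻¹ • mollify k w x‖ₑ ≤ (ENNReal.ofReal W)⁻¹ * (c *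
        ∫⁻ y in Ω, ENNReal.ofReal ((bump n k).normed volume (x - y)) * ‖(2 : ℝ)⁻¹ • w y‖ₑ) := by
      have e1 : (2 * W / c)⁻¹ • mollify k w x
          = W⁻¹ • ((c : ℝ) • mollify k (fun y => (2 : ℝ)⁻¹ • w y) x) := by
        have : mollify k (fun y => (2 : ℝ)⁻¹ • w y) x = (2 : ℝ)⁻¹ • mollify k w x :=
          congrFun (convolution_smul (y := (2 : ℝ)⁻¹) (g := w)) x
        rw [this, smul_smul, smul_smul]
        congr 1
        field_simp
      rw [e1, enorm_smul, enorm_smul, Real.enorm_of_nonneg (by positivity),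
        Real.enorm_of_nonneg hc0'.le, ENNReal.ofReal_inv_of_pos (by positivity),
        ENNReal.ofReal_coe_nnreal]
      gcongr
      exact enorm_mollify_le k hΩ (fun y hy => by rw [hw0 y hy, smul_zero]) x
    refine (conj_mono x hle).trans ((conj_mul_le x ?_ _).trans (by gcongr))
    rw [ENNReal.inv_le_one, ← ENNReal.ofReal_one]
    exact ENNReal.ofReal_le_ofReal hW1
  calc modular Ω (conj φ) (fun x => (2 * W / c)⁻¹ • mollify k w x)
      ≤ ∫⁻ x in Ω, (ENNReal.ofReal W)⁻¹ * (1 + ∫⁻ y in Ω,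
          ENNReal.ofReal ((bump n k).normed volume (x - y)) * conj φ y ‖(2 : ℝ)⁻¹ • w y‖ₑ) :=
        setLIntegral_mono' hΩ hpt
    _ = (ENNReal.ofReal W)⁻¹ * (volume Ω + ∫⁻ x in Ω, ∫⁻ y in Ω,
          ENNReal.ofReal ((bump n k).normed volume (x - y)) * conj φ y ‖(2 : ℝ)⁻¹ • w y‖ₑ) := by
        rw [lintegral_const_mul' _ _ (by simpa using zero_lt_one.trans_le hW1),
          lintegral_add_left measurable_const]
        simp
    _ ≤ (ENNReal.ofReal W)⁻¹ * (volume Ω + 1) := by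
        gcongr
        exact (lintegral_lintegral_bump_le (aemeasurable_conj hΩ hφ hfm) k).trans hmod
    _ = 1 := by
        rw [← hWe]
        exact ENNReal.inv_mul_cancel (by simpa using zero_lt_one.trans_le hW1)
          ENNReal.ofReal_ne_top

/-- Mollifications of a bounded, compactly supported `w` keep its bound and eventually live in one
compact subset of `Ω`, so dominated convergence applies to them directly. -/
theorem assocNorm_le_mul_dualNorm (hΩ : IsOpen Ω) (hΩb : Bornology.IsBounded Ω) {Q : ℝ}
    (hQ : 0 < Q) (hmoll : ∀ (w : Vec n → Mat m n) (k : ℕ),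
      AEStronglyMeasurable w (volume.restrict Ω) → (∀ x ∉ Ω, w x = 0) →
      luxNorm Ω (conj φ) w ≤ 1 → luxNorm Ω (conj φ) (mollify k w) ≤ ENNReal.ofReal Q)
    {u : Vec n → Vec m} {G : Vec n → Mat m n} (h : HasWeakGradient Ω u G) :
    assocNorm Ω (conj φ) G ≤ ENNReal.ofReal Q * dualNorm Ω φ u := by
  refine assocNorm_le_of_forall_bounded hΩ hΩb (fun x _ => conj_mono x) h.locallyIntegrable_grad
    fun w K M hwm hKc hKΩ hM hK hw1 => ?_
  have hli : LocallyIntegrable w :=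
    (integrable_of_bounded_of_compact hwm.aestronglyMeasurable hKc hK hM).locallyIntegrable
  obtain ⟨K', hK'c, hK'Ω, hK'⟩ :=
    exists_mollify_support hΩ hwm.aestronglyMeasurable hKc hKΩ hK
  have hconv := tendsto_setIntegral_inner (v := fun k => mollify k w) h.locallyIntegrable_grad
    hK'c hK'Ω (fun k => (contDiff_mollify k hli).continuous.aestronglyMeasurable)
    (fun k x => norm_mollify_le k hwm.aestronglyMeasurable ((norm_nonneg _).trans (hM x))
      fun y _ => hM y) hK' (ae_restrict_of_ae (ae_tendsto_mollify hli))
  refine le_of_tendsto (ENNReal.tendsto_ofReal hconv) ?_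
  filter_upwards [hK'] with k hk
  have hz : IsTestField Ω (mollify k w) :=
    isTestField_of_eq_zero ((contDiff_mollify k hli).of_le (by exact_mod_cast le_top)) hK'c hK'Ω hk
  exact ofReal_integral_inner_le_mul_dualNorm hΩ h hz hQ
    (hmoll w k hwm.aestronglyMeasurable (fun x hx => hK x fun h => hx (hKΩ h)) hw1)

end Jensen

end GenOrlicz

end

theorem lemma3p6 {n m : ℕ} (hn : 2 ≤ n) (Ω : Set (GenOrlicz.Vec n)) (hΩ : IsOpen Ω)
    (hΩb : Bornology.IsBounded Ω) (φ : GenOrlicz.Vec n → ℝ≥0∞ → ℝ≥0∞)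
    (hφ : GenOrlicz.IsWeakPhi Ω φ) :
    (∀ (u : GenOrlicz.Vec n → GenOrlicz.Vec m) (G : GenOrlicz.Vec n → GenOrlicz.Mat m n),
      GenOrlicz.HasWeakGradient Ω u G →
        GenOrlicz.dualNorm Ω φ u ≤ GenOrlicz.assocNorm Ω (GenOrlicz.conj φ) G ∧
        (GenOrlicz.TestFieldsDense m Ω (GenOrlicz.conj φ) →
          GenOrlicz.dualNorm Ω φ u = GenOrlicz.assocNorm Ω (GenOrlicz.conj φ) G)) ∧
    (GenOrlicz.CondA0 Ω φ → GenOrlicz.CondA1 Ω φ → GenOrlicz.CondADec Ω φ →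
      ∃ C : ℝ≥0, 0 < C ∧
        ∀ (u : GenOrlicz.Vec n → GenOrlicz.Vec m) (G : GenOrlicz.Vec n → GenOrlicz.Mat m n),
          GenOrlicz.HasWeakGradient Ω u G →
            GenOrlicz.dualNorm Ω φ u ≤ C * GenOrlicz.luxNorm Ω φ G ∧
            GenOrlicz.luxNorm Ω φ G ≤ C * GenOrlicz.dualNorm Ω φ u) := by
  have hfin : volume Ω < ∞ := hΩb.measure_lt_top
  refine ⟨fun u G h => ⟨GenOrlicz.dualNorm_le_assocNorm hΩ h, fun hd => le_antisymm
    (GenOrlicz.dualNorm_le_assocNorm hΩ h)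
    (GenOrlicz.assocNorm_le_dualNorm_of_dense hΩ hΩb hφ hd h)⟩, fun _ hA1 hdec => ?_⟩
  obtain ⟨L, hL, hinc⟩ := hφ.almostIncreasing
  obtain ⟨Q, hQ, hmoll⟩ := GenOrlicz.exists_luxNorm_mollify_le hΩ.measurableSet hfin hφ hA1
    (GenOrlicz.Mat m n)
  -- `2` comes from Hölder, `L` from the near-extremal function and `Q` from mollification.
  refine ⟨max 2 (L * Q.toNNReal), lt_max_of_lt_left two_pos, fun u G h => ⟨?_, ?_⟩⟩
  · refine (GenOrlicz.dualNorm_le_assocNorm hΩ h).trans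
      ((GenOrlicz.assocNorm_conj_le hΩ.measurableSet hφ
        h.locallyIntegrable_grad.aestronglyMeasurable).trans ?_)
    gcongr
    exact_mod_cast le_max_left _ _
  · calc GenOrlicz.luxNorm Ω φ G ≤ L * GenOrlicz.assocNorm Ω (GenOrlicz.conj φ) G :=
          GenOrlicz.luxNorm_le_assocNorm hΩ.measurableSet hφ
            (fun x hx t => hdec.lt_top hφ hx t) hL hinc
            h.locallyIntegrable_grad.aestronglyMeasurable hfin
      _ ≤ L * (ENNReal.ofReal Q * GenOrlicz.dualNorm Ω φ u) := by
          gcongr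
          exact GenOrlicz.assocNorm_le_mul_dualNorm hΩ hΩb hQ hmoll h
      _ = ((L * Q.toNNReal : ℝ≥0) : ℝ≥0∞) * GenOrlicz.dualNorm Ω φ u := by
          rw [ENNReal.coe_mul, mul_assoc]; rfl
      _ ≤ _ := by
          gcongr
          exact le_max_right _ _
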